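/- Work over $\mathbb{C}$. Let $W=\mathbb{C}^n$ and let $\mathbf F=\bigoplus_{k\ge 0}F^k\subset \operatorname{Sym}(W^*)=\mathbb{C}[x_1,\dots,x_n]$ be a symbol system of rank $2$, that is, a graded subspace with $F^0=\mathbb{C}$, $F^1=W^*$, $F^2\neq 0$ and $F^k=0$ for $k\ge 3$ (for $k=1,2$ all directional derivatives of elements of $F^{k+1}$ then lie in $F^k$). Let $Q_1,\dots,Q_c$ be a basis of $F^2$. Put $V_{\mathbf F}=\mathbb{C}\oplus W\oplus (F^2)^*$, with coordinates $w_0;\,w_1,\dots,w_n;\,w_{n+1},\dots,w_{n+c}$, where $w_{n+j}$ is evaluation at $Q_j$. Let $M(\mathbf F)\subset\mathbb{P}V_{\mathbf F}$ be the Zariski closure of the image of the rational map $$\mathbb{P}(\mathbb{C}\oplus W)\dashrightarrow \mathbb{P}V_{\mathbf F},\qquad [t:w]\mapsto [t^2: t\,w: Q_1(w):\dots:Q_c(w)],$$ let $Y\subset\mathbb{P}V_{\mathbf F}$ be the common zero set of the $c$ quadrics $w_0w_{n+j}-Q_j(w_1,\dots,w_n)$, $1\le j\le c$, and let $\mathbf{Bs}(\mathbf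 F)=\{Q_1=\dots=Q_c=0\}\subset\mathbb{P}W$. For $x\in M(\mathbf F)$ let $\mathcal{L}_x(M(\mathbf F))\subset\mathbb{P}(T_xM(\mathbf F))$ be the set of tangent directions at $x$ of the lines $l\subset\mathbb{P}V_{\mathbf F}$ with $x\in l\subset M(\mathbf F)$. A closed algebraic subset $Z$ (possibly reducible or empty) of a projective space $\mathbb{P}(E)$ has codimension $\dim\mathbb{P}(E)-\dim Z$, where $\dim\emptyset=-1$; it is a set-theoretic complete intersection of codimension $c$ if it has codimension $c$ and is, as a set, the intersection of $c$ hypersurfaces, i.e. the common zero set of $c$ homogeneous polynomials of positive degree. Then for a general point $x\in M(\mathbf F)$ (that is, for all $x$ in some dense Zariski open subset of $M(\mathbf F)$ consisting of nonsingular points) the following are equivalent: 1. $M(\mathbf F)$ is quadratic, i.e. $M(\mathbf F)=Y$; 2. $\mathbf{Bs}(\mathbf F)\subset\mathbb{P}W$ is a set-theoretic complete intersection of codimension $c$; 3. $\mathcal{L}_x(M(\mathbf F))\subset\mathbb{P}(T_xM(\mathbf F))$ is a set-theoretic complete intersection of codimension $c$; 4. $\operatorname{codim}_{\mathbb{P}W}\mathbf{Bs}(\mathbf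 F)=c$. -/

import Mathlib

namespace EulerSymmetric

noncomputable section

/-! ### Projective algebraic sets in the projectivization of a complex vector space -/

section Projective

variable {E : Type*} [AddCommGroup E] [Module ℂ E]

/-- Evaluation at `v : E` of a polynomial expression in linear forms on `E`. The functions
`v ↦ evalAt v p` are exactly the polynomial functions on `E`, and those with `p` homogeneous of
degree `d` are exactly the homogeneous polynomial functions of degree `d`. -/
def evalAt (v : E) : MvPolynomial (Module.Dual ℂ E) ℂ →ₐ[ℂ] ℂ :=
  MvPolynomial.aeval fun φ => φ v

/-- Common zeros in `ℙ(E)` of a set of polynomials. For homogeneous polynomials, and for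
homogeneous ideals, this does not depend on the representative of a point. -/
def zeroLocus (S : Set (MvPolynomial (Module.Dual ℂ E) ℂ)) : Set (Projectivization ℂ E) :=
  {x | ∀ p ∈ S, evalAt x.rep p = 0}

/-- The affine cone over `Z ⊆ ℙ(E)`; it contains `0`, also when `Z` is empty. -/
def cone (Z : Set (Projectivization ℂ E)) : Set E :=
  {v | ∀ h : v ≠ 0, Projectivization.mk ℂ v h ∈ Z}

/-- The (homogeneous) ideal of all polynomials vanishing on the affine cone over `Z`. -/
def vanishingIdeal (Z : Set (Projectivization ℂ E)) :
    Ideal (MvPolynomial (Module.Dual ℂ E) ℂ) :=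
  ⨅ v ∈ cone Z, RingHom.ker (evalAt v)

/-- Closure in the Zariski topology of `ℙ(E)`. -/
def zariskiClosure (Z : Set (Projectivization ℂ E)) : Set (Projectivization ℂ E) :=
  zeroLocus (vanishingIdeal Z)

def IsZariskiClosed (Z : Set (Projectivization ℂ E)) : Prop :=
  zariskiClosure Z = Z

/-- `U` is a dense Zariski open subset of `Z`. -/
def IsDenseOpenIn (U Z : Set (Projectivization ℂ E)) : Prop :=
  (∃ C, IsZariskiClosed C ∧ U = Z \ C) ∧ Z ⊆ zariskiClosure U

/-- Krull dimension of the homogeneous coordinate ring of `Z`, that is, the dimension of the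
affine cone over `Z`. It equals `dim Z + 1`, with the convention `dim ∅ = -1`. -/
def coneDim (Z : Set (Projectivization ℂ E)) : WithBot ℕ∞ :=
  ringKrullDim (MvPolynomial (Module.Dual ℂ E) ℂ ⧸ vanishingIdeal Z)

/-- `Z ⊆ ℙ(E)` has codimension `b`: `dim Z + b = dim ℙ(E)`, both sides increased by one.
In particular the empty set has codimension `dim E`. -/
def HasCodim (Z : Set (Projectivization ℂ E)) (b : ℕ) : Prop :=
  coneDim Z + (b : WithBot ℕ∞) = (Module.finrank ℂ E : WithBot ℕ∞)

/-- `Z` has codimension `c` and is the intersection of `c` hypersurfaces. -/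
def IsSetTheoreticCI (c : ℕ) (Z : Set (Projectivization ℂ E)) : Prop :=
  HasCodim Z c ∧
    ∃ (g : Fin c → MvPolynomial (Module.Dual ℂ E) ℂ) (d : Fin c → ℕ),
      (∀ i, 0 < d i ∧ (g i).IsHomogeneous (d i)) ∧ Z = zeroLocus (Set.range g)

/-- The differential at `u : E` of the polynomial function defined by `p`. -/
def differentialAt (p : MvPolynomial (Module.Dual ℂ E) ℂ) (u : E) : Module.Dual ℂ E :=
  ∑ φ ∈ p.vars, evalAt u (MvPolynomial.pderiv φ p) • φ

/-- The tangent space to the affine cone over `Z` at a nonzero vector on the line `x`. -/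
def coneTangentSpace (Z : Set (Projectivization ℂ E)) (x : Projectivization ℂ E) :
    Submodule ℂ E :=
  ⨅ p ∈ vanishingIdeal Z, LinearMap.ker (differentialAt p x.rep)

/-- The Zariski tangent space `T_x Z`, as the tangent space of the affine cone modulo the line
`x` (up to the usual twist by a one-dimensional space, which does not change `ℙ(T_x Z)`). -/
abbrev TangentSpace (Z : Set (Projectivization ℂ E)) (x : Projectivization ℂ E) : Type _ :=
  coneTangentSpace Z x ⧸ x.submodule.submoduleOf (coneTangentSpace Z x)

/-- `x` is a point of the (irreducible) `Z` with `dim T_x Z = dim Z`. -/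
def IsNonsingularPoint (Z : Set (Projectivization ℂ E)) (x : Projectivization ℂ E) : Prop :=
  x ∈ Z ∧ coneDim Z = ((Module.finrank ℂ (TangentSpace Z x) + 1 : ℕ) : WithBot ℕ∞)

/-- The lines `l ⊆ ℙ(E)` with `x ∈ l ⊆ Z`, as two-dimensional subspaces of `E`. -/
def linesThrough (Z : Set (Projectivization ℂ E)) (x : Projectivization ℂ E) :
    Set (Submodule ℂ E) :=
  {L | Module.finrank ℂ L = 2 ∧ x.submodule ≤ L ∧ (L : Set E) ⊆ cone Z}

/-- The line of `ℙ(E)` through `x` with tangent direction `τ ∈ ℙ(T_x Z)`. -/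
def lineInDirection {Z : Set (Projectivization ℂ E)} {x : Projectivization ℂ E}
    (τ : Projectivization ℂ (TangentSpace Z x)) : Submodule ℂ E :=
  (τ.submodule.comap (Submodule.mkQ _)).map (coneTangentSpace Z x).subtype

/-- The variety of lines `𝓛_x(Z)`, embedded in `ℙ(T_x Z)` by sending a line to its tangent
direction at `x`. -/
def varietyOfLines (Z : Set (Projectivization ℂ E)) (x : Projectivization ℂ E) :
    Set (Projectivization ℂ (TangentSpace Z x)) :=
  {τ | lineInDirection τ ∈ linesThrough Z x}

end Projective

/-! ### Symbol systems -/

/-- The contraction `ι_w` of a polynomial with `w ∈ W = ℂⁿ`, which is the derivative along `w`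
(on forms of degree `k + 1` up to the nonzero factor `k + 1`, which is irrelevant below). -/
def contract {n : ℕ} (w : Fin n → ℂ) :
    MvPolynomial (Fin n) ℂ →ₗ[ℂ] MvPolynomial (Fin n) ℂ :=
  ∑ i, w i • (MvPolynomial.pderiv i).toLinearMap

/-- The prolongation of a subspace `G` of `Sym^k W^*`. -/
def prolong {n : ℕ} (k : ℕ) (G : Submodule ℂ (MvPolynomial (Fin n) ℂ)) :
    Submodule ℂ (MvPolynomial (Fin n) ℂ) :=
  MvPolynomial.homogeneousSubmodule (Fin n) ℂ (k + 1) ⊓ ⨅ w : Fin n → ℂ, G.comap (contract w)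

/-- A symbol system of rank `r` on `W = ℂⁿ`, with `Sym(W^*) = ℂ[x₁, …, xₙ]`. -/
structure SymbolSystem (n r : ℕ) where
  part : ℕ → Submodule ℂ (MvPolynomial (Fin n) ℂ)
  part_le : ∀ k, part k ≤ MvPolynomial.homogeneousSubmodule (Fin n) ℂ k
  part_zero : part 0 = MvPolynomial.homogeneousSubmodule (Fin n) ℂ 0
  part_one : part 1 = MvPolynomial.homogeneousSubmodule (Fin n) ℂ 1
  part_rank : part r ≠ ⊥
  part_of_gt : ∀ k, r < k → part k = ⊥
  part_succ_le : ∀ k, 1 ≤ k → k ≤ r → part (k + 1) ≤ prolong k (part k)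

namespace SymbolSystem

variable {n : ℕ} (F : SymbolSystem n 2)

/-- `V_F = ℂ ⊕ W ⊕ (F²)^*`. -/
abbrev Ambient : Type := ℂ × (Fin n → ℂ) × Module.Dual ℂ (F.part 2)

/-- `ι²_w ∈ (F²)^*`, the map `φ ↦ φ(w, w)`. -/
def iotaSq (w : Fin n → ℂ) : Module.Dual ℂ (F.part 2) :=
  (MvPolynomial.aeval w).toLinearMap ∘ₗ (F.part 2).subtype

/-- The Euler-symmetric variety `M(F) ⊆ ℙ(V_F)`: the closure of the image of the rational map
`[t : w] ↦ [t² : t w : ι²_w]`. -/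
def variety : Set (Projectivization ℂ F.Ambient) :=
  zariskiClosure {z | ∃ (t : ℂ) (w : Fin n → ℂ) (h : ((t ^ 2, t • w, F.iotaSq w) : F.Ambient) ≠ 0),
    z = Projectivization.mk ℂ ((t ^ 2, t • w, F.iotaSq w) : F.Ambient) h}

/-- The base locus `Bs(F) ⊆ ℙ(W)`, the common zeros of all quadratic forms in `F²`;
it may be empty. -/
def baseLocus : Set (Projectivization ℂ (Fin n → ℂ)) :=
  {w | ∀ φ ∈ F.part 2, MvPolynomial.eval w.rep φ = 0}

variable {F}

/-- The zero set `Y ⊆ ℙ(V_F)` of the quadrics `w₀ w_{n+j} - Q_j(w₁, …, wₙ)`, where `w_{n+j}` is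
the coordinate on `(F²)^*` given by evaluation at `Q_j`. -/
def quadricLocus {c : ℕ} (Q : Module.Basis (Fin c) ℂ (F.part 2)) :
    Set (Projectivization ℂ F.Ambient) :=
  {z | ∀ j, z.rep.1 * z.rep.2.2 (Q j) -
    MvPolynomial.eval z.rep.2.1 (Q j : MvPolynomial (Fin n) ℂ) = 0}

/-- `M(F)` is quadratic. -/
def IsQuadratic {c : ℕ} (Q : Module.Basis (Fin c) ℂ (F.part 2)) : Prop :=
  F.variety = quadricLocus Q

end SymbolSystem

end

end EulerSymmetric

/-!
Write `Y` for the zero set of the quadrics `w₀ w_{n+j} - Q_j`. Off the hyperplane `w₀ = 0`, both `Y`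
and `M(F)` are the graph of `w ↦ (Q_j(w))`; on that hyperplane `Y` is the cone over the base locus
with vertex `ℙ((F²)^*)`. So everything depends on whether this boundary lies in `M(F)`. Since
`M(F)` is irreducible of dimension `n` (`ringKrullDim_quotient_idealVariety`), the question is one
of dimension.

* If `M(F) = Y`, the boundary is a hyperplane section of an irreducible variety and has dimension
  at most `n - 1`. Therefore the base locus has codimension at least `c`, and being cut out by `c`
  quadrics it has codimension exactly `c` (`hasCodim_of_isQuadratic`).
* Conversely, a point of `Y` outside `M(F)` lies on a component of `Y` contained in the boundary.
  By Krull's height theorem this component has dimension at least `n`, whereas the boundary has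
  dimension `n - 1` if the base locus has codimension `c` (`isQuadratic_of_hasCodim`). This is where
  the dimension inequality `N ≤ height p + dim k[x₁, …, x_N]/p` is needed; it is derived from
  Noether normalization and going-down (`MvPolynomial.le_height_add_ringKrullDim_quotient`).

For the lines, let `x = [u]` with `u₀ ≠ 0`. The tangent space at `x` is cut out by the linearized
quadrics (`mem_coneTangentSpace_iff`), and projecting it away from `u` and `(F²)^*` identifies it
with `W`. A line in tangent direction `w` lies on `M(F)` if and only if all `Q_j(w)` vanish
(`cone_baseLocus_eq_image`). Hence `𝓛_x(M(F))` is projectively equivalent to the base locus, with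
the same codimension, and defined by equations of the same degrees.
-/

/-! ### Dimension theory of affine algebras -/

section Dimension

open Ideal

/-- An integral extension has the same Krull dimension, by incomparability and going-up. -/
theorem ringKrullDim_eq_of_isIntegral (R S : Type*) [CommRing R] [CommRing S] [Algebra R S]
    [Algebra.IsIntegral R S] [FaithfulSMul R S] : ringKrullDim S = ringKrullDim R := by
  apply le_antisymm
  · refine Order.krullDim_le_of_strictMono (PrimeSpectrum.comap (algebraMap R S)) ?_
    intro P Q h
    exact Ideal.IsIntegral.comap_lt_comap (I := P.asIdeal) (J := Q.asIdeal) h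
  · refine iSup_le fun l => ?_
    obtain ⟨P, hP, hPl⟩ := exists_ideal_over_prime_of_isIntegral (S := S) l.head.asIdeal ⊥
      (by
        rw [← RingHom.ker_eq_comap_bot,
          (RingHom.injective_iff_ker_eq_bot _).1 (FaithfulSMul.algebraMap_injective R S)]
        exact bot_le)
    have : P.LiesOver l.head.asIdeal := ⟨hPl.2.symm⟩
    have := hPl.1
    obtain ⟨L, hL, -⟩ := Ideal.exists_ltSeries_of_hasGoingUp l P
    rw [← hL]
    exact Order.LTSeries.length_le_krullDim L

theorem ringKrullDim_eq_of_isIntegral_algHom {k R S : Type*} [CommRing k] [CommRing R] [CommRing S]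
    [Algebra k R] [Algebra k S] (g : R →ₐ[k] S) (hg : Function.Injective g)
    (hi : g.IsIntegral) : ringKrullDim S = ringKrullDim R := by
  algebraize [g.toRingHom]
  have : FaithfulSMul R S := (faithfulSMul_iff_algebraMap_injective R S).2 hg
  exact ringKrullDim_eq_of_isIntegral R S

variable {k : Type*} [Field k]

/-- Polynomial rings over a field are equidimensional: every maximal ideal of
`k[x₁, …, xₙ]` has height `n`. -/
theorem MvPolynomial.height_of_isMaximal {n : ℕ} (m : Ideal (MvPolynomial (Fin n) k))
    [hm : m.IsMaximal] : m.height = n := by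
  induction n with
  | zero =>
    have h := Ideal.height_le_ringKrullDim_of_ne_top hm.ne_top
    rw [MvPolynomial.ringKrullDim_of_isNoetherianRing, ringKrullDim_eq_zero_of_field] at h
    have h' : m.height ≤ 0 := by simpa using h
    simpa using h'
  | succ n ih =>
    let e := (MvPolynomial.finSuccEquiv k n).toRingEquiv
    have hM : (m.map e).IsMaximal := Ideal.map_isMaximal_of_equiv e
    have : ((m.map e).comap Polynomial.C).IsMaximal :=
      Polynomial.isMaximal_comap_C_of_isJacobsonRing (m.map e)
    have : (m.map e).LiesOver ((m.map e).comap Polynomial.C) := ⟨rfl⟩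
    rw [← e.height_map m, Polynomial.height_eq_height_add_one
      ((m.map e).comap Polynomial.C) (m.map e), ih]
    simp

theorem height_add_one_le_height_of_mem {R : Type*} [CommRing R] [IsDomain R] [IsNoetherianRing R]
    {f : R} (hf : f ≠ 0) {p : Ideal R} [p.IsPrime] (hfp : f ∈ p) :
    (p.map (Ideal.Quotient.mk (span {f}))).height + 1 ≤ p.height := by
  have hle : span {f} ≤ p := by simpa [span_le] using hfp
  have : (p.map (Ideal.Quotient.mk (span {f}))).IsPrime := isPrime_map_quotientMk_of_isPrime hle
  obtain ⟨l, hl, hlen⟩ :=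
    (p.map (Ideal.Quotient.mk (span {f}))).exists_ltSeries_length_eq_height
  let l' := l.map (PrimeSpectrum.comap (Ideal.Quotient.mk (span {f})))
    (RingHom.strictMono_comap_of_surjective Ideal.Quotient.mk_surjective)
  have hlast : l'.last = ⟨p, inferInstance⟩ := by
    ext1
    simp only [l', LTSeries.last_map, hl, PrimeSpectrum.comap_asIdeal]
    rw [Ideal.comap_map_of_surjective _ Ideal.Quotient.mk_surjective, ← RingHom.ker_eq_comap_bot,
      Ideal.mk_ker, sup_eq_left]
    exact hle
  have hhead : (⟨⊥, Ideal.isPrime_bot⟩ : PrimeSpectrum R) < l'.head := by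
    rw [← PrimeSpectrum.asIdeal_lt_asIdeal, bot_lt_iff_ne_bot]
    intro h
    have : f ∈ l'.head.asIdeal := by
      simp only [l', LTSeries.head_map, PrimeSpectrum.comap_asIdeal, Ideal.mem_comap]
      rw [Ideal.Quotient.eq_zero_iff_mem.2 (Ideal.mem_span_singleton_self f)]
      exact zero_mem _
    rw [h] at this
    exact hf this
  have h1 : ((l'.cons _ hhead).length : ℕ∞) ≤ Order.height (l'.cons _ hhead).last :=
    Order.length_le_height_last
  rw [RelSeries.last_cons, hlast, ← PrimeSpectrum.height_eq_orderHeight] at h1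
  rw [← hlen]
  simpa [l'] using h1

/-- The dimension formula for a prime ideal of a polynomial ring, in the form of the inequality
`n ≤ height p + dim k[x₁, …, xₙ]/p`. For `p ≠ 0` choose a prime element `f ∈ p`, normalize
`k[x₁, …, xₙ]/(f)` over a polynomial ring in `n - 1` variables, and go down. -/
theorem MvPolynomial.le_height_add_ringKrullDim_quotient {n : ℕ}
    (p : Ideal (MvPolynomial (Fin n) k)) [hp : p.IsPrime] :
    (n : WithBot ℕ∞) ≤ p.height + ringKrullDim (MvPolynomial (Fin n) k ⧸ p) := by
  induction n using Nat.strong_induction_on with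
  | _ n ih =>
  by_cases hbot : p = ⊥
  · subst hbot
    rw [ringKrullDim_eq_of_ringEquiv (RingEquiv.quotientBot _),
      MvPolynomial.ringKrullDim_of_isNoetherianRing, ringKrullDim_eq_zero_of_field]
    simp
  obtain ⟨f, hfp, hf⟩ := hp.exists_mem_prime_of_ne_bot hbot
  have hle : span {f} ≤ p := by simpa [span_le] using hfp
  have hfprime : (span {f}).IsPrime := (span_singleton_prime hf.ne_zero).2 hf
  obtain ⟨s, -, g, hg, hgi⟩ := exists_integral_inj_algHom_of_quotient (span {f}) hfprime.ne_top
  -- the number `s` of parameters is `n - 1`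
  have hs : n ≤ s + 1 := by
    obtain ⟨m, hm, hpm⟩ := p.exists_le_maximal hp.ne_top
    have h1 := Ideal.height_le_ringKrullDim_quotient_add_one (hpm hfp)
    rw [MvPolynomial.height_of_isMaximal m, ringKrullDim_eq_of_isIntegral_algHom g hg hgi,
      MvPolynomial.ringKrullDim_of_isNoetherianRing, ringKrullDim_eq_zero_of_field] at h1
    simp only [zero_add, Nat.card_fin] at h1
    exact_mod_cast h1
  have hs' : s < n := by
    have h1 := ringKrullDim_quotient_succ_le_of_nonZeroDivisor
      (mem_nonZeroDivisors_of_ne_zero hf.ne_zero)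
    rw [ringKrullDim_eq_of_isIntegral_algHom g hg hgi,
      MvPolynomial.ringKrullDim_of_isNoetherianRing,
      MvPolynomial.ringKrullDim_of_isNoetherianRing, ringKrullDim_eq_zero_of_field] at h1
    simp only [zero_add, Nat.card_fin] at h1
    exact_mod_cast h1
  have hq : (p.map (Ideal.Quotient.mk (span {f}))).IsPrime := isPrime_map_quotientMk_of_isPrime hle
  algebraize [g.toRingHom]
  have : FaithfulSMul (MvPolynomial (Fin s) k) (MvPolynomial (Fin n) k ⧸ span {f}) :=
    (faithfulSMul_iff_algebraMap_injective _ _).2 hg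
  set q := p.map (Ideal.Quotient.mk (span {f})) with hqdef
  set q' := q.under (MvPolynomial (Fin s) k)
  have hdim : ringKrullDim (MvPolynomial (Fin n) k ⧸ p) =
      ringKrullDim (MvPolynomial (Fin s) k ⧸ q') := by
    rw [← ringKrullDim_eq_of_isIntegral (MvPolynomial (Fin s) k ⧸ q') (_ ⧸ q),
      ringKrullDim_eq_of_ringEquiv (DoubleQuot.quotQuotEquivQuotOfLE hle)]
  have h1 := height_add_one_le_height_of_mem hf.ne_zero hfp
  have h2 := Ideal.height_eq_height_add_of_liesOver_of_hasGoingDown q' q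
  have h3 := ih s hs' q'
  have h4 : q'.height + 1 ≤ p.height := by
    refine le_trans ?_ h1
    gcongr
    rw [← hqdef, h2]
    exact le_self_add
  rw [hdim]
  calc (n : WithBot ℕ∞) ≤ s + 1 := by exact_mod_cast hs
    _ ≤ q'.height + ringKrullDim (MvPolynomial (Fin s) k ⧸ q') + 1 := by gcongr
    _ = (q'.height + 1 : ℕ∞) + ringKrullDim (MvPolynomial (Fin s) k ⧸ q') := by
      push_cast; ring
    _ ≤ _ := add_le_add_left (WithBot.coe_le_coe.2 h4) _

theorem MvPolynomial.card_le_height_add_ringKrullDim_quotient {ι : Type*} [Finite ι]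
    (p : Ideal (MvPolynomial ι k)) [hp : p.IsPrime] :
    (Nat.card ι : WithBot ℕ∞) ≤ p.height + ringKrullDim (MvPolynomial ι k ⧸ p) := by
  let e := (MvPolynomial.renameEquiv k (Finite.equivFin ι)).toRingEquiv
  have : (p.map e).IsPrime := Ideal.map_isPrime_of_equiv e
  rw [← e.height_map p, ringKrullDim_eq_of_ringEquiv (Ideal.quotientEquiv p (p.map e) e rfl)]
  exact MvPolynomial.le_height_add_ringKrullDim_quotient (p.map e)

theorem MvPolynomial.card_le_of_injective {s : ℕ} {ι : Type*} [Finite ι]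
    (g : MvPolynomial (Fin s) k →ₐ[k] MvPolynomial ι k) (hg : Function.Injective g) :
    s ≤ Nat.card ι := by
  have : Fintype ι := Fintype.ofFinite ι
  have h : AlgebraicIndependent k (fun i => g (X i)) := by
    rw [algebraicIndependent_iff_injective_aeval]
    convert hg
    ext; simp
  have := h.lift_cardinalMk_le_trdeg
  rw [MvPolynomial.trdeg_of_isDomain] at this
  rw [Cardinal.mk_fin, Cardinal.mk_fintype] at this
  rw [Nat.card_eq_fintype_card]
  simpa using this

/-- An affine algebra that embeds into a polynomial ring has at most the dimension of that ring,
since the variables of a Noether normalization stay algebraically independent there. -/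
theorem MvPolynomial.ringKrullDim_quotient_ker_le {σ ι : Type*} [Finite σ] [Finite ι]
    (f : MvPolynomial σ k →ₐ[k] MvPolynomial ι k) :
    ringKrullDim (MvPolynomial σ k ⧸ RingHom.ker f) ≤ Nat.card ι := by
  have : Nontrivial (MvPolynomial σ k ⧸ RingHom.ker f) :=
    Ideal.Quotient.nontrivial_iff.2 (RingHom.ker_ne_top f)
  obtain ⟨s, g, hg, hgi⟩ := exists_integral_inj_algHom_of_fg k (MvPolynomial σ k ⧸ RingHom.ker f)
  rw [ringKrullDim_eq_of_isIntegral_algHom g hg hgi,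
    MvPolynomial.ringKrullDim_of_isNoetherianRing, ringKrullDim_eq_zero_of_field]
  have := MvPolynomial.card_le_of_injective ((Ideal.kerLiftAlg f).comp g)
    ((Ideal.kerLiftAlg_injective f).comp hg)
  simp only [zero_add, Nat.card_fin]
  exact_mod_cast this

end Dimension

namespace EulerSymmetric

noncomputable section

/-! ### Cones, closures and coordinates -/

section ProjectiveLemmas

variable {E : Type*} [AddCommGroup E] [Module ℂ E]

@[simp]
theorem evalAt_X (v : E) (φ : Module.Dual ℂ E) : evalAt v (MvPolynomial.X φ) = φ v := by
  simp [evalAt]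

theorem evalAt_rename {σ : Type*} (f : σ → Module.Dual ℂ E) (v : E) (p : MvPolynomial σ ℂ) :
    evalAt v (MvPolynomial.rename f p) = MvPolynomial.eval (fun i => f i v) p := by
  rw [evalAt, MvPolynomial.aeval_rename, ← MvPolynomial.coe_aeval_eq_eval]
  rfl

/-- Substitution of `a • v` for `v`. -/
def scalePoly (a : ℂ) :
    MvPolynomial (Module.Dual ℂ E) ℂ →ₐ[ℂ] MvPolynomial (Module.Dual ℂ E) ℂ :=
  MvPolynomial.aeval fun φ => a • MvPolynomial.X φ

theorem evalAt_scalePoly (a : ℂ) (v : E) (p : MvPolynomial (Module.Dual ℂ E) ℂ) :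
    evalAt v (scalePoly a p) = evalAt (a • v) p := by
  change ((evalAt v).comp (scalePoly a)) p = _
  congr 1
  ext φ
  simp [scalePoly]

theorem eval_smul_of_isHomogeneous {σ : Type*} {p : MvPolynomial σ ℂ} {d : ℕ}
    (hp : p.IsHomogeneous d) (a : ℂ) (f : σ → ℂ) :
    MvPolynomial.eval (a • f) p = a ^ d * MvPolynomial.eval f p := by
  rw [MvPolynomial.eval_eq, MvPolynomial.eval_eq, Finset.mul_sum]
  refine Finset.sum_congr rfl fun m hm => ?_
  have hm' : m.degree = d := by
    rw [Finsupp.degree_eq_weight_one]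
    exact hp (MvPolynomial.mem_support_iff.1 hm)
  simp only [Pi.smul_apply, smul_eq_mul, mul_pow, Finset.prod_mul_distrib,
    Finset.prod_pow_eq_pow_sum]
  rw [← hm', Finsupp.degree]
  ring_nf
  rfl

theorem evalAt_smul_of_isHomogeneous {p : MvPolynomial (Module.Dual ℂ E) ℂ} {d : ℕ}
    (hp : p.IsHomogeneous d) (a : ℂ) (v : E) : evalAt (a • v) p = a ^ d * evalAt v p := by
  have h : (MvPolynomial.aeval fun φ : Module.Dual ℂ E => a * φ v) p =
      a ^ d * MvPolynomial.aeval (fun φ : Module.Dual ℂ E => φ v) p := by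
    rw [MvPolynomial.aeval_eq_eval, MvPolynomial.aeval_eq_eval]
    exact eval_smul_of_isHomogeneous hp a _
  simpa [evalAt] using h

theorem zero_mem_cone (Z : Set (Projectivization ℂ E)) : (0 : E) ∈ cone Z :=
  fun h => absurd rfl h

theorem smul_mem_cone {Z : Set (Projectivization ℂ E)} {v : E} (hv : v ∈ cone Z) (a : ℂ) :
    a • v ∈ cone Z := by
  intro h
  have hv0 : v ≠ 0 := fun h0 => h (by simp [h0])
  have ha : a ≠ 0 := fun h0 => h (by simp [h0])
  have : Projectivization.mk ℂ (a • v) h = Projectivization.mk ℂ v hv0 :=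
    (Projectivization.mk_eq_mk_iff' ℂ _ _ _ _).2 ⟨a, rfl⟩
  rw [this]
  exact hv hv0

theorem rep_mem_cone_iff {Z : Set (Projectivization ℂ E)} {x : Projectivization ℂ E} :
    x.rep ∈ cone Z ↔ x ∈ Z :=
  ⟨fun h => by simpa using h x.rep_nonzero, fun h _ => by simpa using h⟩

theorem mk_mem_iff_mem_cone {Z : Set (Projectivization ℂ E)} {v : E} (hv : v ≠ 0) :
    Projectivization.mk ℂ v hv ∈ Z ↔ v ∈ cone Z :=
  ⟨fun h _ => h, fun h => h hv⟩

theorem eq_of_cone_eq {Z Z' : Set (Projectivization ℂ E)} (h : cone Z = cone Z') : Z = Z' := by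
  ext x
  rw [← rep_mem_cone_iff, h, rep_mem_cone_iff]

theorem mem_vanishingIdeal {Z : Set (Projectivization ℂ E)}
    {p : MvPolynomial (Module.Dual ℂ E) ℂ} :
    p ∈ vanishingIdeal Z ↔ ∀ v ∈ cone Z, evalAt v p = 0 := by
  simp [vanishingIdeal, RingHom.mem_ker]

theorem scalePoly_mem_vanishingIdeal {Z : Set (Projectivization ℂ E)}
    {p : MvPolynomial (Module.Dual ℂ E) ℂ} (hp : p ∈ vanishingIdeal Z) (a : ℂ) :
    scalePoly a p ∈ vanishingIdeal Z := by
  rw [mem_vanishingIdeal] at hp ⊢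
  intro v hv
  rw [evalAt_scalePoly]
  exact hp _ (smul_mem_cone hv a)

theorem mem_cone_zariskiClosure {Z : Set (Projectivization ℂ E)} {v : E} :
    v ∈ cone (zariskiClosure Z) ↔ ∀ p ∈ vanishingIdeal Z, evalAt v p = 0 := by
  constructor
  · intro h p hp
    by_cases hv : v = 0
    · exact hv ▸ mem_vanishingIdeal.1 hp 0 (zero_mem_cone Z)
    obtain ⟨a, ha⟩ := Projectivization.exists_smul_eq_mk_rep ℂ v hv
    have h1 := h hv (scalePoly (a : ℂ)⁻¹ p) (scalePoly_mem_vanishingIdeal hp _)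
    rw [evalAt_scalePoly, ← ha, Units.smul_def, inv_smul_smul₀ a.ne_zero] at h1
    exact h1
  · intro h hv p hp
    obtain ⟨a, ha⟩ := Projectivization.exists_smul_eq_mk_rep ℂ v hv
    rw [← ha, Units.smul_def, ← evalAt_scalePoly]
    exact h _ (scalePoly_mem_vanishingIdeal hp _)

theorem subset_zariskiClosure (Z : Set (Projectivization ℂ E)) : Z ⊆ zariskiClosure Z :=
  fun _ hx _ hp => mem_vanishingIdeal.1 hp _ (rep_mem_cone_iff.2 hx)

theorem vanishingIdeal_zariskiClosure (Z : Set (Projectivization ℂ E)) :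
    vanishingIdeal (zariskiClosure Z) = vanishingIdeal Z := by
  ext p
  rw [mem_vanishingIdeal]
  constructor
  · exact fun h => mem_vanishingIdeal.2
      fun v hv => h v fun hv0 => subset_zariskiClosure Z (hv hv0)
  · exact fun h v hv => mem_cone_zariskiClosure.1 hv p h

theorem isZariskiClosed_zeroLocus_singleton_X (φ : Module.Dual ℂ E) :
    IsZariskiClosed (zeroLocus {MvPolynomial.X φ} : Set (Projectivization ℂ E)) := by
  refine Set.Subset.antisymm ?_ (subset_zariskiClosure _)
  intro x hx p hp
  rw [Set.mem_singleton_iff.1 hp]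
  refine hx _ (mem_vanishingIdeal.2 fun v hv => ?_)
  by_cases hv0 : v = 0
  · simp [hv0]
  obtain ⟨a, ha⟩ := Projectivization.exists_smul_eq_mk_rep ℂ v hv0
  have h1 := hv hv0 _ rfl
  rw [evalAt_X, ← ha, Units.smul_def, map_smul, smul_eq_mul] at h1
  simpa using h1

/-- The surjection from polynomial expressions in linear forms on `E` to polynomials in the
coordinates given by `e`. -/
def toCoords {ι : Type*} [Finite ι] (e : E ≃ₗ[ℂ] (ι → ℂ)) :
    MvPolynomial (Module.Dual ℂ E) ℂ →ₐ[ℂ] MvPolynomial ι ℂ :=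
  letI := Fintype.ofFinite ι
  letI := Classical.decEq ι
  MvPolynomial.aeval fun φ => ∑ i, φ (e.symm (Pi.single i 1)) • MvPolynomial.X i

theorem aeval_toCoords {ι : Type*} [Finite ι] (e : E ≃ₗ[ℂ] (ι → ℂ)) (v : E)
    (p : MvPolynomial (Module.Dual ℂ E) ℂ) :
    MvPolynomial.aeval (e v) (toCoords e p) = evalAt v p := by
  let _ := Fintype.ofFinite ι
  let _ := Classical.decEq ι
  change ((MvPolynomial.aeval (e v)).comp (toCoords e)) p = _
  congr 1
  ext φ
  have : φ v = φ (e.symm (∑ i, e v i • Pi.single i (1 : ℂ))) := by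
    rw [← pi_eq_sum_univ' (e v), e.symm_apply_apply]
  simp only [toCoords, AlgHom.comp_apply, MvPolynomial.aeval_X, map_sum, map_smul, smul_eq_mul,
    evalAt_X, this]
  exact Finset.sum_congr rfl fun i _ => mul_comm _ _

theorem toCoords_rename {ι : Type*} [Finite ι] (e : E ≃ₗ[ℂ] (ι → ℂ)) (q : MvPolynomial ι ℂ) :
    toCoords e (MvPolynomial.rename (fun i => LinearMap.proj i ∘ₗ e.toLinearMap) q) = q := by
  classical
  change ((toCoords e).comp (MvPolynomial.rename _)) q = AlgHom.id ℂ _ q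
  congr 1
  ext1 i
  simp [toCoords, Pi.single_apply]

/-- The dimension of a cone may be computed in any coordinates. -/
theorem coneDim_eq {ι : Type*} [Finite ι] (e : E ≃ₗ[ℂ] (ι → ℂ))
    (Z : Set (Projectivization ℂ E)) :
    coneDim Z = ringKrullDim
      (MvPolynomial ι ℂ ⧸ MvPolynomial.vanishingIdeal ℂ (e '' cone Z)) := by
  have hsurj : Function.Surjective (toCoords e) := fun q => ⟨_, toCoords_rename e q⟩
  have hI : vanishingIdeal Z =
      (MvPolynomial.vanishingIdeal ℂ (e '' cone Z)).comap (toCoords e) := by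
    ext p
    rw [mem_vanishingIdeal, Ideal.mem_comap, MvPolynomial.mem_vanishingIdeal_iff,
      Set.forall_mem_image]
    simp only [aeval_toCoords]
  let f := (Ideal.Quotient.mkₐ ℂ (MvPolynomial.vanishingIdeal ℂ (e '' cone Z))).comp (toCoords e)
  have hker : RingHom.ker f.toRingHom = vanishingIdeal Z := by
    rw [hI]
    ext p
    simp [f, RingHom.mem_ker, Ideal.Quotient.eq_zero_iff_mem]
  rw [coneDim, ← hker]
  exact ringKrullDim_eq_of_ringEquiv (RingHom.quotientKerEquivOfSurjective
    (f := f.toRingHom) (Ideal.Quotient.mk_surjective.comp hsurj))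

variable {E' : Type*} [AddCommGroup E'] [Module ℂ E']

/-- The codimension is invariant under linear equivalence of projective spaces. -/
theorem hasCodim_iff_of_linearEquiv [FiniteDimensional ℂ E] (e : E ≃ₗ[ℂ] E')
    {Z : Set (Projectivization ℂ E)} {Z' : Set (Projectivization ℂ E')}
    (h : cone Z' = e '' cone Z) (b : ℕ) :
    HasCodim Z b ↔ HasCodim Z' b := by
  let f := (Module.finBasis ℂ E).equivFun
  rw [HasCodim, HasCodim, coneDim_eq f, coneDim_eq (e.symm.trans f), ← e.finrank_eq, h,
    ← Set.image_comp]
  have : ⇑(e.symm.trans f) ∘ e = f := by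
    ext1 v
    simp
  rw [this]

theorem mem_cone_zeroLocus {σ : Type*} {g : σ → MvPolynomial (Module.Dual ℂ E) ℂ} {d : σ → ℕ}
    (hg : ∀ i, 0 < d i ∧ (g i).IsHomogeneous (d i)) {v : E} :
    v ∈ cone (zeroLocus (Set.range g)) ↔ ∀ i, evalAt v (g i) = 0 := by
  by_cases hv : v = 0
  · subst hv
    refine ⟨fun _ i => ?_, fun _ => zero_mem_cone _⟩
    have := evalAt_smul_of_isHomogeneous (hg i).2 0 (0 : E)
    rwa [zero_smul, zero_pow (hg i).1.ne', zero_mul] at this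
  obtain ⟨a, ha⟩ := Projectivization.exists_smul_eq_mk_rep ℂ v hv
  rw [← mk_mem_iff_mem_cone hv]
  simp only [zeroLocus, Set.mem_ofPred_eq, Set.forall_mem_range, ← ha, Units.smul_def]
  refine forall_congr' fun i => ?_
  rw [evalAt_smul_of_isHomogeneous (hg i).2]
  simp

theorem IsSetTheoreticCI.of_linearEquiv [FiniteDimensional ℂ E] (e : E ≃ₗ[ℂ] E')
    {Z : Set (Projectivization ℂ E)} {Z' : Set (Projectivization ℂ E')}
    (h : cone Z' = e '' cone Z) {c : ℕ}
    (hZ : IsSetTheoreticCI c Z) : IsSetTheoreticCI c Z' := by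
  obtain ⟨hc, g, d, hg, rfl⟩ := hZ
  have hg' : ∀ i, 0 < d i ∧ (MvPolynomial.rename
      (fun φ : Module.Dual ℂ E => φ ∘ₗ e.symm.toLinearMap) (g i)).IsHomogeneous (d i) :=
    fun i => ⟨(hg i).1, (hg i).2.rename_isHomogeneous⟩
  have : FiniteDimensional ℂ E' := e.finiteDimensional
  refine ⟨(hasCodim_iff_of_linearEquiv e h c).1 hc, _, d, hg', eq_of_cone_eq ?_⟩
  ext v
  rw [h, mem_cone_zeroLocus hg', ← e.coe_toEquiv, Equiv.image_eq_preimage_symm, Set.mem_preimage,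
    mem_cone_zeroLocus hg]
  refine forall_congr' fun i => ?_
  rw [evalAt_rename, evalAt, MvPolynomial.aeval_eq_eval]
  rfl

/-! ### Tangent spaces -/

theorem differentialAt_apply_eq_sum (p : MvPolynomial (Module.Dual ℂ E) ℂ) (u v : E)
    {S : Finset (Module.Dual ℂ E)} (hS : p.vars ⊆ S) :
    differentialAt p u v = ∑ φ ∈ S, evalAt u (MvPolynomial.pderiv φ p) * φ v := by
  rw [differentialAt, LinearMap.sum_apply]
  refine Finset.sum_subset hS fun φ _ h => ?_
  rw [MvPolynomial.pderiv_eq_zero_of_notMem_vars h]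
  simp

theorem differentialAt_C (a : ℂ) (u : E) : differentialAt (MvPolynomial.C a) u = 0 := by
  simp [differentialAt]

theorem differentialAt_add (p q : MvPolynomial (Module.Dual ℂ E) ℂ) (u v : E) :
    differentialAt (p + q) u v = differentialAt p u v + differentialAt q u v := by
  classical
  rw [differentialAt_apply_eq_sum (p + q) u v (MvPolynomial.vars_add_subset p q),
    differentialAt_apply_eq_sum p u v (Finset.subset_union_left (s₂ := q.vars)),
    differentialAt_apply_eq_sum q u v (Finset.subset_union_right (s₁ := p.vars)),
    ← Finset.sum_add_distrib]
  simp [add_mul]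

theorem differentialAt_mul_X (p : MvPolynomial (Module.Dual ℂ E) ℂ) (φ : Module.Dual ℂ E)
    (u v : E) : differentialAt (p * MvPolynomial.X φ) u v =
      differentialAt p u v * φ u + evalAt u p * φ v := by
  classical
  have hX : (MvPolynomial.X φ : MvPolynomial (Module.Dual ℂ E) ℂ).vars = {φ} :=
    MvPolynomial.vars_X
  rw [differentialAt_apply_eq_sum _ u v (MvPolynomial.vars_mul p (MvPolynomial.X φ)),
    differentialAt_apply_eq_sum p u v
      (Finset.subset_union_left (s₂ := (MvPolynomial.X φ : MvPolynomial _ ℂ).vars)),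
    Finset.sum_mul]
  have h : ∀ ψ, evalAt u (MvPolynomial.pderiv ψ (p * MvPolynomial.X φ)) * ψ v =
      evalAt u (MvPolynomial.pderiv ψ p) * ψ v * φ u +
        (if ψ = φ then evalAt u p * φ v else 0) := by
    intro ψ
    rw [Derivation.leibniz, MvPolynomial.pderiv_X]
    by_cases hψ : ψ = φ
    · subst hψ
      simp
      ring
    · simp [hψ, Ne.symm hψ]
      ring
  simp only [h, Finset.sum_add_distrib, Finset.sum_ite_eq', hX]
  simp

/-- The restriction of a polynomial function on `E` to the parabola `s ↦ a + s b + s² c`. -/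
def alongParabola (a b c : E) : MvPolynomial (Module.Dual ℂ E) ℂ →ₐ[ℂ] Polynomial ℂ :=
  MvPolynomial.aeval fun φ => Polynomial.C (φ a) + Polynomial.X * Polynomial.C (φ b) +
    Polynomial.X ^ 2 * Polynomial.C (φ c)

theorem eval_alongParabola (a b c : E) (s : ℂ) (p : MvPolynomial (Module.Dual ℂ E) ℂ) :
    (alongParabola a b c p).eval s = evalAt (a + s • b + s ^ 2 • c) p := by
  change ((Polynomial.evalRingHom s).comp (alongParabola a b c).toRingHom) p =
    (evalAt (a + s • b + s ^ 2 • c)).toRingHom p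
  congr 1
  ext φ
  · simp
  · simp [alongParabola]
    ring

theorem eval_derivative_alongParabola (a b c : E) (p : MvPolynomial (Module.Dual ℂ E) ℂ) :
    (alongParabola a b c p).derivative.eval 0 = differentialAt p a b := by
  induction p using MvPolynomial.induction_on with
  | C z =>
    rw [differentialAt_C]
    simp [alongParabola]
  | add p q hp hq => simp [differentialAt_add, hp, hq]
  | mul_X p φ hp =>
    rw [differentialAt_mul_X, map_mul, Polynomial.derivative_mul, Polynomial.eval_add,
      Polynomial.eval_mul, Polynomial.eval_mul, hp, eval_alongParabola, eval_alongParabola]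
    simp [alongParabola]

theorem mem_coneTangentSpace {Z : Set (Projectivization ℂ E)} {x : Projectivization ℂ E} {v : E} :
    v ∈ coneTangentSpace Z x ↔ ∀ p ∈ vanishingIdeal Z, differentialAt p x.rep v = 0 := by
  simp [coneTangentSpace]

/-- The velocity of a parabola in a cone is a tangent vector. -/
theorem mem_coneTangentSpace_of_parabola {Z : Set (Projectivization ℂ E)}
    {x : Projectivization ℂ E} {b : E} (c : E)
    (h : ∀ s : ℂ, x.rep + s • b + s ^ 2 • c ∈ cone Z) : b ∈ coneTangentSpace Z x := by
  rw [mem_coneTangentSpace]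
  intro p hp
  have h0 : alongParabola x.rep b c p = 0 :=
    Polynomial.funext fun s => by
      rw [eval_alongParabola, mem_vanishingIdeal.1 hp _ (h s), Polynomial.eval_zero]
  rw [← eval_derivative_alongParabola x.rep b c, h0]
  simp

/-- A polynomial that vanishes on a parabola except possibly at one point vanishes there too. -/
theorem evalAt_eq_zero_of_forall_ne (a b c : E) {p : MvPolynomial (Module.Dual ℂ E) ℂ}
    (h : ∀ s : ℂ, s ≠ 0 → evalAt (a + s • b + s ^ 2 • c) p = 0) : evalAt a p = 0 := by
  have h0 : alongParabola a b c p = 0 := by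
    refine Polynomial.eq_zero_of_infinite_isRoot _
      ((Set.finite_singleton (0 : ℂ)).infinite_compl.mono ?_)
    intro s hs
    change Polynomial.eval s _ = 0
    rw [eval_alongParabola]
    exact h s hs
  have := eval_alongParabola a b c 0 p
  rw [h0] at this
  simpa using this.symm

end ProjectiveLemmas

/-! ### The parametrization and the ideal of `M(F)` -/

theorem natCast_le_of_add_le {a b : ℕ} {D : WithBot ℕ∞}
    (h : ((a + b : ℕ) : WithBot ℕ∞) ≤ (b : WithBot ℕ∞) + D) : (a : WithBot ℕ∞) ≤ D := by
  induction D with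
  | bot => simp at h
  | coe D =>
    induction D using ENat.recTopCoe with
    | top => exact le_top
    | coe d =>
      have h' : a + b ≤ b + d := by exact_mod_cast h
      exact_mod_cast (by omega : a ≤ d)

/-- The polarization of a quadratic form. -/
theorem exists_symm_bilin {n : ℕ} {p : MvPolynomial (Fin n) ℂ} (hp : p.IsHomogeneous 2) :
    ∃ B : (Fin n → ℂ) →ₗ[ℂ] (Fin n → ℂ) →ₗ[ℂ] ℂ,
      (∀ v w, B v w = B w v) ∧ ∀ w, MvPolynomial.eval w p = B w w := by
  have h1 : ∀ i j, ∃ m : ℂ, MvPolynomial.pderiv j (MvPolynomial.pderiv i p) = MvPolynomial.C m :=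
    fun i j => ⟨_, MvPolynomial.totalDegree_eq_zero_iff_eq_C.1
      ((MvPolynomial.totalDegree_zero_iff_isHomogeneous _).2 (hp.pderiv (i := i)).pderiv)⟩
  choose M hM using h1
  let B : (Fin n → ℂ) →ₗ[ℂ] (Fin n → ℂ) →ₗ[ℂ] ℂ := Matrix.toLinearMap₂' ℂ (Matrix.of M)
  have h2 : ∀ i, MvPolynomial.pderiv i p = ∑ j, MvPolynomial.X j * MvPolynomial.C (M i j) := by
    intro i
    have h := (hp.pderiv (i := i)).sum_X_mul_pderiv
    simp only [hM] at h
    simpa using h.symm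
  have h3 : ∀ w, 2 * MvPolynomial.eval w p = B w w := by
    intro w
    have h := congrArg (MvPolynomial.eval w) hp.sum_X_mul_pderiv
    rw [map_nsmul, nsmul_eq_mul, Nat.cast_ofNat] at h
    simp only [h2, map_sum, map_mul, MvPolynomial.eval_X, MvPolynomial.eval_C] at h
    rw [← h, Matrix.toLinearMap₂'_apply]
    simp only [Finset.mul_sum, smul_eq_mul]
    rfl
  refine ⟨(1 / 4 : ℂ) • (B + B.flip), fun v w => ?_, fun w => ?_⟩
  · simp [add_comm]
  · simp only [LinearMap.smul_apply, LinearMap.add_apply, LinearMap.flip_apply, ← h3, smul_eq_mul]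
    ring

namespace SymbolSystem

variable {n c : ℕ} (F : SymbolSystem n 2)

theorem isHomogeneous_two (φ : F.part 2) : (φ : MvPolynomial (Fin n) ℂ).IsHomogeneous 2 :=
  F.part_le 2 φ.2

theorem iotaSq_apply (w : Fin n → ℂ) (φ : F.part 2) :
    F.iotaSq w φ = MvPolynomial.eval w (φ : MvPolynomial (Fin n) ℂ) := by
  simp [iotaSq, MvPolynomial.aeval_eq_eval]

theorem iotaSq_smul (a : ℂ) (w : Fin n → ℂ) : F.iotaSq (a • w) = a ^ 2 • F.iotaSq w := by
  ext φ
  simp [iotaSq_apply, eval_smul_of_isHomogeneous (F.isHomogeneous_two φ)]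

/-- The parametrization `(t, w) ↦ (t², t w, ι²_w)` of the affine cone over `M(F)`. -/
def param (t : ℂ) (w : Fin n → ℂ) : F.Ambient := (t ^ 2, t • w, F.iotaSq w)

theorem param_smul (a t : ℂ) (w : Fin n → ℂ) :
    F.param (a * t) (a • w) = a ^ 2 • F.param t w := by
  simp only [param, iotaSq_smul, Prod.smul_mk, smul_eq_mul, mul_pow, smul_smul]
  congr 3
  ring

theorem mem_vanishingIdeal_variety {p : MvPolynomial (Module.Dual ℂ F.Ambient) ℂ} :
    p ∈ vanishingIdeal F.variety ↔ ∀ t w, evalAt (F.param t w) p = 0 := by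
  rw [variety, vanishingIdeal_zariskiClosure, mem_vanishingIdeal]
  constructor
  · exact fun h t w => h _ fun hne => ⟨t, w, hne, rfl⟩
  · intro h v hv
    by_cases hv0 : v = 0
    · have := h (0 * 0) ((0 : ℂ) • 0)
      rw [param_smul] at this
      simpa [hv0] using this
    obtain ⟨t, w, hne, heq⟩ := hv hv0
    obtain ⟨a, rfl⟩ := (Projectivization.mk_eq_mk_iff' ℂ _ _ hv0 hne).1 heq
    -- scalars are absorbed by rescaling the parameters by a square root
    obtain ⟨s, rfl⟩ := IsAlgClosed.exists_pow_nat_eq a (n := 2) (by norm_num)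
    have := h (s * t) (s • w)
    rwa [param_smul] at this

theorem mem_cone_variety {v : F.Ambient} :
    v ∈ cone F.variety ↔ ∀ p, (∀ t w, evalAt (F.param t w) p = 0) → evalAt v p = 0 := by
  have : zariskiClosure F.variety = F.variety := by
    rw [variety, zariskiClosure, vanishingIdeal_zariskiClosure]
    rfl
  rw [← this, mem_cone_zariskiClosure]
  simp only [mem_vanishingIdeal_variety]

theorem param_mem_cone_variety (t : ℂ) (w : Fin n → ℂ) : F.param t w ∈ cone F.variety :=
  F.mem_cone_variety.2 fun _ h => h t w

variable {F} (Q : Module.Basis (Fin c) ℂ (F.part 2))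

/-- The coordinates `w₀; w₁, …, wₙ; w_{n+1}, …, w_{n+c}` on `V_F`. -/
def coords : F.Ambient ≃ₗ[ℂ] (Option (Fin n ⊕ Fin c) → ℂ) where
  toFun v i := i.elim v.1 (Sum.elim v.2.1 fun j => v.2.2 (Q j))
  invFun x := (x none, fun i => x (some (Sum.inl i)), Q.constr ℂ fun j => x (some (Sum.inr j)))
  map_add' v v' := by ext (_ | _ | _) <;> simp
  map_smul' a v := by ext (_ | _ | _) <;> simp
  left_inv v := by
    refine Prod.ext rfl (Prod.ext rfl (Q.ext fun j => ?_))
    simp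
  right_inv x := by ext (_ | _ | _) <;> simp

@[simp] theorem coords_none (v : F.Ambient) : coords Q v none = v.1 := rfl

@[simp] theorem coords_inl (v : F.Ambient) (i : Fin n) :
    coords Q v (some (Sum.inl i)) = v.2.1 i := rfl

@[simp] theorem coords_inr (v : F.Ambient) (j : Fin c) :
    coords Q v (some (Sum.inr j)) = v.2.2 (Q j) := rfl

/-- A polynomial in the coordinates, as a polynomial expression in linear forms. -/
def ofCoords : MvPolynomial (Option (Fin n ⊕ Fin c)) ℂ →ₐ[ℂ]
    MvPolynomial (Module.Dual ℂ F.Ambient) ℂ :=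
  MvPolynomial.rename fun i => LinearMap.proj i ∘ₗ (coords Q).toLinearMap

theorem evalAt_ofCoords (v : F.Ambient) (p : MvPolynomial (Option (Fin n ⊕ Fin c)) ℂ) :
    evalAt v (ofCoords Q p) = MvPolynomial.eval (coords Q v) p := by
  rw [ofCoords, evalAt_rename]
  rfl

/-- The quadric `w₀ w_{n+j} - Q_j(w₁, …, wₙ)`. -/
def quadric (j : Fin c) : MvPolynomial (Option (Fin n ⊕ Fin c)) ℂ :=
  MvPolynomial.X none * MvPolynomial.X (some (Sum.inr j)) -
    MvPolynomial.rename (fun i => some (Sum.inl i)) (Q j : MvPolynomial (Fin n) ℂ)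

theorem eval_coords_quadric (v : F.Ambient) (j : Fin c) :
    MvPolynomial.eval (coords Q v) (quadric Q j) =
      v.1 * v.2.2 (Q j) - MvPolynomial.eval v.2.1 (Q j : MvPolynomial (Fin n) ℂ) := by
  simp only [quadric, map_sub, map_mul, MvPolynomial.eval_X, coords_none, coords_inr,
    MvPolynomial.eval_rename]
  rfl

theorem mem_cone_quadricLocus {v : F.Ambient} :
    v ∈ cone (quadricLocus Q) ↔
      ∀ j, v.1 * v.2.2 (Q j) = MvPolynomial.eval v.2.1 (Q j : MvPolynomial (Fin n) ℂ) := by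
  by_cases hv : v = 0
  · subst hv
    refine ⟨fun _ j => ?_, fun _ => zero_mem_cone _⟩
    have := eval_smul_of_isHomogeneous (F.isHomogeneous_two (Q j)) 0 0
    simpa using this.symm
  obtain ⟨a, ha⟩ := Projectivization.exists_smul_eq_mk_rep ℂ v hv
  rw [← mk_mem_iff_mem_cone hv]
  simp only [quadricLocus, Set.mem_ofPred_eq, ← ha, Units.smul_def]
  refine forall_congr' fun j => ?_
  simp only [Prod.smul_fst, Prod.smul_snd, LinearMap.smul_apply, smul_eq_mul]
  rw [eval_smul_of_isHomogeneous (F.isHomogeneous_two (Q j)),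
    show (a : ℂ) * v.1 * (a * v.2.2 (Q j)) - a ^ 2 * MvPolynomial.eval v.2.1 (Q j).1 =
      a ^ 2 * (v.1 * v.2.2 (Q j) - MvPolynomial.eval v.2.1 (Q j).1) by ring,
    mul_eq_zero, or_iff_right (pow_ne_zero 2 a.ne_zero), sub_eq_zero]

theorem eval_quadric_param (t : ℂ) (w : Fin n → ℂ) (j : Fin c) :
    MvPolynomial.eval (coords Q (F.param t w)) (quadric Q j) = 0 := by
  rw [eval_coords_quadric]
  simp [param, iotaSq_apply, eval_smul_of_isHomogeneous (F.isHomogeneous_two (Q j))]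

theorem cone_variety_subset : cone F.variety ⊆ cone (quadricLocus Q) := by
  intro v hv
  rw [mem_cone_quadricLocus]
  intro j
  have := F.mem_cone_variety.1 hv (ofCoords Q (quadric Q j)) fun t w => by
    rw [evalAt_ofCoords, eval_quadric_param]
  rwa [evalAt_ofCoords, eval_coords_quadric, sub_eq_zero] at this

/-- Off the hyperplane `w₀ = 0`, the variety `M(F)` is cut out by the quadrics. -/
theorem mem_cone_variety_of_fst_ne_zero {v : F.Ambient} (h0 : v.1 ≠ 0)
    (hv : v ∈ cone (quadricLocus Q)) : v ∈ cone F.variety := by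
  obtain ⟨s, hs⟩ := IsAlgClosed.exists_pow_nat_eq v.1 (n := 2) (by norm_num)
  have hs0 : s ≠ 0 := by
    rintro rfl
    exact h0 (by rw [← hs]; simp)
  rw [mem_cone_quadricLocus] at hv
  have : v = F.param s (s⁻¹ • v.2.1) := by
    refine Prod.ext hs.symm (Prod.ext ?_ (Q.ext fun j => ?_))
    · simp [param, smul_smul, hs0]
    · simp only [param, iotaSq_smul, LinearMap.smul_apply, iotaSq_apply, ← hv j, smul_eq_mul, ← hs]
      field_simp
  rw [this]
  exact F.param_mem_cone_variety _ _

/-- The ideal of `M(F)` in the coordinates. -/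
def idealVariety : Ideal (MvPolynomial (Option (Fin n ⊕ Fin c)) ℂ) :=
  MvPolynomial.vanishingIdeal ℂ (coords Q '' cone F.variety)

theorem mem_idealVariety {p : MvPolynomial (Option (Fin n ⊕ Fin c)) ℂ} :
    p ∈ idealVariety Q ↔ ∀ v ∈ cone F.variety, MvPolynomial.eval (coords Q v) p = 0 := by
  rw [idealVariety, MvPolynomial.mem_vanishingIdeal_iff, Set.forall_mem_image]
  rfl

theorem mem_idealVariety_iff_param {p : MvPolynomial (Option (Fin n ⊕ Fin c)) ℂ} :
    p ∈ idealVariety Q ↔ ∀ t w, MvPolynomial.eval (coords Q (F.param t w)) p = 0 := by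
  rw [mem_idealVariety]
  constructor
  · exact fun h t w => h _ (F.param_mem_cone_variety t w)
  · intro h v hv
    rw [← evalAt_ofCoords]
    refine F.mem_cone_variety.1 hv _ fun t w => ?_
    rw [evalAt_ofCoords]
    exact h t w

/-- The homomorphism of coordinate rings induced by the parametrization. -/
def paramHom : MvPolynomial (Option (Fin n ⊕ Fin c)) ℂ →ₐ[ℂ] MvPolynomial (Option (Fin n)) ℂ :=
  MvPolynomial.aeval fun i => i.elim (MvPolynomial.X none ^ 2)
    (Sum.elim (fun i => MvPolynomial.X none * MvPolynomial.X (some i))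
      fun j => MvPolynomial.rename some (Q j : MvPolynomial (Fin n) ℂ))

theorem eval_paramHom (x : Option (Fin n) → ℂ) (p : MvPolynomial (Option (Fin n ⊕ Fin c)) ℂ) :
    MvPolynomial.eval x (paramHom Q p) =
      MvPolynomial.eval (coords Q (F.param (x none) fun i => x (some i))) p := by
  change ((MvPolynomial.aeval x).comp (paramHom Q)) p = MvPolynomial.aeval _ p
  congr 1
  ext (_ | _ | j)
  · simp [paramHom, param]
  · simp [paramHom, param]
  · simp only [paramHom, param, AlgHom.comp_apply, MvPolynomial.aeval_X, Option.elim_some,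
      Sum.elim_inr, coords_inr, iotaSq_apply, MvPolynomial.aeval_rename]
    rfl

theorem idealVariety_eq_ker : idealVariety Q = RingHom.ker (paramHom Q) := by
  ext p
  rw [mem_idealVariety_iff_param, RingHom.mem_ker]
  constructor
  · intro h
    refine MvPolynomial.funext fun x => ?_
    rw [eval_paramHom, h, map_zero]
  · intro h t w
    have := eval_paramHom Q (fun i => i.elim t w) p
    rw [h, map_zero] at this
    exact this.symm

instance : (idealVariety Q).IsPrime := by
  rw [idealVariety_eq_ker]
  exact RingHom.ker_isPrime _

theorem X_none_notMem_idealVariety : MvPolynomial.X none ∉ idealVariety Q := by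
  rw [idealVariety_eq_ker, RingHom.mem_ker]
  simp [paramHom]

/-- The ideal generated by the quadrics. -/
def quadricIdeal : Ideal (MvPolynomial (Option (Fin n ⊕ Fin c)) ℂ) :=
  Ideal.span (Set.range (quadric Q))

theorem quadricIdeal_le_idealVariety : quadricIdeal Q ≤ idealVariety Q := by
  rw [quadricIdeal, Ideal.span_le]
  rintro _ ⟨j, rfl⟩
  exact (mem_idealVariety_iff_param Q).2 fun t w => eval_quadric_param Q t w j

/-- By the Nullstellensatz: `M(F)` and the zero set of the quadrics agree off `w₀ = 0`. -/
theorem X_none_mul_mem_radical {f : MvPolynomial (Option (Fin n ⊕ Fin c)) ℂ}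
    (hf : f ∈ idealVariety Q) : MvPolynomial.X none * f ∈ (quadricIdeal Q).radical := by
  rw [← MvPolynomial.vanishingIdeal_zeroLocus_eq_radical (K := ℂ)]
  intro x hx
  obtain ⟨v, rfl⟩ := (coords Q).surjective x
  rw [quadricIdeal, MvPolynomial.zeroLocus_span] at hx
  rw [map_mul, MvPolynomial.aeval_X, coords_none, mul_eq_zero, or_iff_not_imp_left]
  intro h0
  refine (mem_idealVariety Q).1 hf v (mem_cone_variety_of_fst_ne_zero Q h0 ?_)
  rw [mem_cone_quadricLocus]
  intro j
  have : MvPolynomial.eval (coords Q v) (quadric Q j) = 0 := hx _ ⟨j, rfl⟩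
  rwa [eval_coords_quadric, sub_eq_zero] at this

theorem height_le_of_mem_minimalPrimes_quadricIdeal
    {p : Ideal (MvPolynomial (Option (Fin n ⊕ Fin c)) ℂ)}
    (hp : p ∈ (quadricIdeal Q).minimalPrimes) : p.height ≤ c := by
  classical
  have h : (Set.range (quadric Q)) = ((Finset.univ.image (quadric Q) : Finset _) : Set _) := by
    simp
  rw [quadricIdeal, h] at hp
  refine (Ideal.height_le_card_of_mem_minimalPrimes_span_finset hp).trans ?_
  exact_mod_cast Finset.card_image_le.trans_eq (by simp)

/-- `M(F)` is an irreducible component of the zero set of the quadrics. -/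
theorem idealVariety_mem_minimalPrimes : idealVariety Q ∈ (quadricIdeal Q).minimalPrimes := by
  obtain ⟨p, hp, hpI⟩ := Ideal.exists_minimalPrimes_le (quadricIdeal_le_idealVariety Q)
  have := hp.isPrime
  suffices h : idealVariety Q ≤ p by rwa [le_antisymm h hpI]
  intro f hf
  refine (this.mem_or_mem (this.radical_le_iff.2 hp.1.2 (X_none_mul_mem_radical Q hf))).resolve_left
    fun h => X_none_notMem_idealVariety Q (hpI h)

/-- The affine cone over `M(F)` has dimension `n + 1`: at most because its coordinate ring embeds
into `ℂ[t, w₁, …, wₙ]`, at least because `M(F)` is a component of an intersection of `c` quadrics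
in a space of affine dimension `n + c + 1`. -/
theorem ringKrullDim_quotient_idealVariety :
    ringKrullDim (MvPolynomial (Option (Fin n ⊕ Fin c)) ℂ ⧸ idealVariety Q) =
      (n + 1 : ℕ) := by
  apply le_antisymm
  · rw [idealVariety_eq_ker]
    simpa using MvPolynomial.ringKrullDim_quotient_ker_le (paramHom Q)
  · have h := MvPolynomial.card_le_height_add_ringKrullDim_quotient (idealVariety Q)
    refine natCast_le_of_add_le (b := c) ?_
    calc ((n + 1 + c : ℕ) : WithBot ℕ∞) = (Nat.card (Option (Fin n ⊕ Fin c)) : WithBot ℕ∞) := by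
          simp [add_right_comm]
      _ ≤ _ := h
      _ ≤ _ := by
        gcongr
        exact_mod_cast height_le_of_mem_minimalPrimes_quadricIdeal Q
          (idealVariety_mem_minimalPrimes Q)

theorem coneDim_variety (Q : Module.Basis (Fin c) ℂ (F.part 2)) :
    coneDim F.variety = (n + 1 : ℕ) := by
  rw [coneDim_eq (coords Q)]
  exact ringKrullDim_quotient_idealVariety Q

/-! ### Tangent spaces and lines of `M(F)` off the hyperplane `w₀ = 0` -/

section Tangent

variable {B : Fin c → (Fin n → ℂ) →ₗ[ℂ] (Fin n → ℂ) →ₗ[ℂ] ℂ}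
  (hs : ∀ j v w, B j v w = B j w v)
  (hB : ∀ j w, MvPolynomial.eval w (Q j : MvPolynomial (Fin n) ℂ) = B j w w)
  {x : Projectivization ℂ F.Ambient} (hx : x ∈ F.variety) (h0 : x.rep.1 ≠ 0)

include hs hB in
/-- Tangent vectors are annihilated by the differentials of the quadrics. -/
theorem linearized_of_mem_coneTangentSpace {v : F.Ambient}
    (hv : v ∈ coneTangentSpace F.variety x) (j : Fin c) :
    x.rep.1 * v.2.2 (Q j) + v.1 * x.rep.2.2 (Q j) = 2 * B j x.rep.2.1 v.2.1 := by
  have hp : ofCoords Q (quadric Q j) ∈ vanishingIdeal F.variety :=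
    F.mem_vanishingIdeal_variety.2 fun t w => by rw [evalAt_ofCoords, eval_quadric_param]
  have h := mem_coneTangentSpace.1 hv _ hp
  rw [← eval_derivative_alongParabola _ _ 0] at h
  have hP : alongParabola x.rep v 0 (ofCoords Q (quadric Q j)) =
      Polynomial.C (x.rep.1 * x.rep.2.2 (Q j) - B j x.rep.2.1 x.rep.2.1) +
      Polynomial.X * Polynomial.C (x.rep.1 * v.2.2 (Q j) + v.1 * x.rep.2.2 (Q j) -
        2 * B j x.rep.2.1 v.2.1) +
      Polynomial.X ^ 2 * Polynomial.C (v.1 * v.2.2 (Q j) - B j v.2.1 v.2.1) := by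
    refine Polynomial.funext fun s => ?_
    rw [eval_alongParabola, evalAt_ofCoords, eval_coords_quadric, hB]
    simp [hs j v.2.1 x.rep.2.1]
    ring
  rw [hP] at h
  simp only [Polynomial.derivative_add, Polynomial.derivative_C, Polynomial.derivative_mul,
    Polynomial.derivative_X, Polynomial.derivative_X_pow, Polynomial.eval_add, Polynomial.eval_mul,
    Polynomial.eval_C, Polynomial.eval_X, Polynomial.eval_pow, Polynomial.eval_zero,
    Polynomial.eval_one] at h
  linear_combination h

include hx in
theorem rep_mem_coneTangentSpace : x.rep ∈ coneTangentSpace F.variety x := by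
  refine mem_coneTangentSpace_of_parabola 0 fun s => ?_
  have := smul_mem_cone (rep_mem_cone_iff.2 hx) (1 + s)
  rw [add_smul, one_smul] at this
  simpa using this

include hs hB hx h0 in
/-- The tangent space at a point with `w₀ ≠ 0` is cut out by the differentials of the quadrics.
For a solution `v`, the curve `s ↦ u₀⁻¹ • param (u₀ + s v₀) (u' + s v')` in the cone, with `u'` and
`v'` the components in `W`, passes through `u` with velocity `v + (v₀ / u₀) u`. -/
theorem mem_coneTangentSpace_iff {v : F.Ambient} :
    v ∈ coneTangentSpace F.variety x ↔
      ∀ j, x.rep.1 * v.2.2 (Q j) + v.1 * x.rep.2.2 (Q j) = 2 * B j x.rep.2.1 v.2.1 := by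
  refine ⟨linearized_of_mem_coneTangentSpace Q hs hB, fun h => ?_⟩
  have hx' := (mem_cone_quadricLocus Q).1 (cone_variety_subset Q (rep_mem_cone_iff.2 hx))
  suffices h' : v + (v.1 / x.rep.1) • x.rep ∈ coneTangentSpace F.variety x by
    have := Submodule.sub_mem _ h'
      (Submodule.smul_mem _ (v.1 / x.rep.1) (rep_mem_coneTangentSpace hx))
    rwa [add_sub_cancel_right] at this
  refine mem_coneTangentSpace_of_parabola (x.rep.1⁻¹ • F.param v.1 v.2.1) fun s => ?_
  have hmem := smul_mem_cone
    (F.param_mem_cone_variety (x.rep.1 + s * v.1) (x.rep.2.1 + s • v.2.1)) x.rep.1⁻¹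
  convert hmem using 1
  generalize x.rep = u at *
  refine Prod.ext ?_ (Prod.ext ?_ (Q.ext fun j => ?_))
  · simp only [param, Prod.fst_add, Prod.smul_fst, smul_eq_mul]
    field_simp
    ring
  · ext i
    simp only [param, Prod.snd_add, Prod.fst_add, Prod.smul_snd, Prod.smul_fst, smul_eq_mul,
      Pi.add_apply, Pi.smul_apply]
    field_simp
    ring
  · have h1 := h j
    have h2 := hx' j
    rw [hB] at h2
    simp only [param, Prod.snd_add, Prod.smul_snd, smul_eq_mul, LinearMap.add_apply,
      LinearMap.smul_apply, iotaSq_apply, hB, map_add, map_smul, hs j v.2.1 u.2.1]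
    field_simp
    linear_combination h2 + s * h1

/-- The projection of `V_F` onto `W` with kernel `⟨u⟩ ⊕ (F²)^*`. -/
def direction (u : F.Ambient) : F.Ambient →ₗ[ℂ] (Fin n → ℂ) :=
  LinearMap.fst ℂ _ _ ∘ₗ LinearMap.snd ℂ _ _ -
    (LinearMap.fst ℂ ℂ _).smulRight (u.1⁻¹ • u.2.1)

theorem direction_apply (u v : F.Ambient) :
    direction u v = v.2.1 - (v.1 / u.1) • u.2.1 := by
  simp [direction, smul_smul, div_eq_mul_inv]

theorem direction_self {u : F.Ambient} (h : u.1 ≠ 0) : direction u u = 0 := by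
  simp [direction_apply, h]

include hs hB hx h0 in
theorem mem_submodule_of_direction_eq_zero {v : F.Ambient}
    (hv : v ∈ coneTangentSpace F.variety x) (hd : direction x.rep v = 0) :
    v = (v.1 / x.rep.1) • x.rep := by
  have hx' := (mem_cone_quadricLocus Q).1 (cone_variety_subset Q (rep_mem_cone_iff.2 hx))
  have hv' := (mem_coneTangentSpace_iff Q hs hB hx h0).1 hv
  rw [direction_apply, sub_eq_zero] at hd
  generalize x.rep = u at *
  refine Prod.ext ?_ (Prod.ext hd (Q.ext fun j => ?_))
  · simp [h0]
  · have h1 := hv' j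
    have h2 := hx' j
    rw [hB] at h2
    rw [hd, map_smul, ← h2] at h1
    simp only [Prod.smul_snd, LinearMap.smul_apply, smul_eq_mul] at h1 ⊢
    field_simp at h1 ⊢
    linear_combination h1

include hs hB hx h0 in
theorem ker_direction :
    LinearMap.ker (direction x.rep ∘ₗ (coneTangentSpace F.variety x).subtype) =
      x.submodule.submoduleOf (coneTangentSpace F.variety x) := by
  ext ⟨v, hv⟩
  rw [LinearMap.mem_ker, Submodule.submoduleOf, Submodule.mem_comap, x.submodule_eq,
    Submodule.mem_span_singleton]
  constructor
  · exact fun h => ⟨_, (mem_submodule_of_direction_eq_zero Q hs hB hx h0 hv h).symm⟩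
  · rintro ⟨a, ha⟩
    change direction x.rep v = 0
    change a • x.rep = v at ha
    rw [← ha, map_smul, direction_self h0, smul_zero]

include hs hB hx h0 in
theorem direction_surjective :
    Function.Surjective (direction x.rep ∘ₗ (coneTangentSpace F.variety x).subtype) := by
  intro w
  refine ⟨⟨(0, w, Q.constr ℂ fun j => 2 * B j x.rep.2.1 w / x.rep.1), ?_⟩, ?_⟩
  · rw [mem_coneTangentSpace_iff Q hs hB hx h0]
    intro j
    simp only [Module.Basis.constr_basis]
    field_simp
    simp
  · simp [direction_apply]

/-- The identification of `T_x M(F)` with `W`. -/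
def tangentEquiv : TangentSpace F.variety x ≃ₗ[ℂ] (Fin n → ℂ) :=
  (Submodule.quotEquivOfEq _ _ (ker_direction Q hs hB hx h0).symm).trans
    (LinearMap.quotKerEquivOfSurjective _ (direction_surjective Q hs hB hx h0))

theorem tangentEquiv_mkQ (v : coneTangentSpace F.variety x) :
    tangentEquiv Q hs hB hx h0 (Submodule.mkQ _ v) = direction x.rep v := by
  simp [tangentEquiv]

include Q hs hB hx h0 in
theorem isNonsingularPoint : IsNonsingularPoint F.variety x := by
  refine ⟨hx, ?_⟩
  rw [coneDim_variety Q, (tangentEquiv Q hs hB hx h0).finrank_eq]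
  simp

theorem mem_cone_baseLocus {w : Fin n → ℂ} :
    w ∈ cone F.baseLocus ↔ ∀ j, MvPolynomial.eval w (Q j : MvPolynomial (Fin n) ℂ) = 0 := by
  have key : (∀ φ ∈ F.part 2, MvPolynomial.eval w φ = 0) ↔
      ∀ j, MvPolynomial.eval w (Q j : MvPolynomial (Fin n) ℂ) = 0 := by
    refine ⟨fun h j => h _ (Q j).2, fun h φ hφ => ?_⟩
    have : F.iotaSq w = 0 := Q.ext fun j => by rw [iotaSq_apply, h j, LinearMap.zero_apply]
    rw [← F.iotaSq_apply w ⟨φ, hφ⟩, this, LinearMap.zero_apply]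
  rw [← key]
  by_cases hw : w = 0
  · subst hw
    refine ⟨fun _ φ hφ => ?_, fun _ => zero_mem_cone _⟩
    have := eval_smul_of_isHomogeneous (F.part_le 2 hφ) 0 0
    simpa using this
  obtain ⟨a, ha⟩ := Projectivization.exists_smul_eq_mk_rep ℂ w hw
  rw [← mk_mem_iff_mem_cone hw]
  simp only [baseLocus, Set.mem_ofPred_eq, ← ha, Units.smul_def]
  refine forall₂_congr fun φ hφ => ?_
  rw [eval_smul_of_isHomogeneous (F.part_le 2 hφ), mul_eq_zero,
    or_iff_right (pow_ne_zero 2 a.ne_zero)]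

include hs hB hx h0 in
/-- A tangent vector whose direction lies in the base locus is contained in `M(F)`. -/
theorem mem_cone_variety_of_direction {z : F.Ambient} (hz : z ∈ coneTangentSpace F.variety x)
    (hd : direction x.rep z ∈ cone F.baseLocus) : z ∈ cone F.variety := by
  have hx' := (mem_cone_quadricLocus Q).1 (cone_variety_subset Q (rep_mem_cone_iff.2 hx))
  have main : ∀ z ∈ coneTangentSpace F.variety x, direction x.rep z ∈ cone F.baseLocus →
      z.1 ≠ 0 → z ∈ cone F.variety := by
    intro z hz hd hz0
    refine mem_cone_variety_of_fst_ne_zero Q hz0 ((mem_cone_quadricLocus Q).2 fun j => ?_)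
    have h1 := (mem_coneTangentSpace_iff Q hs hB hx h0).1 hz j
    have h2 := hx' j
    have h3 := (mem_cone_baseLocus Q).1 hd j
    rw [direction_apply] at h3
    rw [hB] at h2 h3 ⊢
    simp only [map_sub, map_smul, LinearMap.sub_apply, LinearMap.smul_apply, smul_eq_mul,
      hs j z.2.1 x.rep.2.1, ← h2] at h3
    field_simp at h3
    have h4 : x.rep.1 * (z.1 * z.2.2 (Q j) - B j z.2.1 z.2.1) = 0 := by
      linear_combination z.1 * h1 - h3
    exact sub_eq_zero.1 ((mul_eq_zero.1 h4).resolve_left h0)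
  -- on the hyperplane `w₀ = 0`, approximate `z` by the points `z + s u` of the same line
  by_cases hz0 : z.1 = 0
  · rw [mem_cone_variety]
    intro p hp
    refine evalAt_eq_zero_of_forall_ne z x.rep 0 fun s hs' => ?_
    rw [smul_zero, add_zero]
    refine F.mem_cone_variety.1 (main _ ?_ ?_ ?_) p hp
    · exact Submodule.add_mem _ hz (Submodule.smul_mem _ _ (rep_mem_coneTangentSpace hx))
    · rwa [map_add, map_smul, direction_self h0, smul_zero, add_zero]
    · simp [hz0, hs', h0]
  · exact main z hz hd hz0

include hs hB hx h0 in
theorem lineInDirection_mk {v : coneTangentSpace F.variety x}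
    (hv : Submodule.mkQ (x.submodule.submoduleOf (coneTangentSpace F.variety x)) v ≠ 0) :
    lineInDirection (Projectivization.mk ℂ _ hv) = Submodule.span ℂ {x.rep, (v : F.Ambient)} := by
  ext z
  rw [lineInDirection, Projectivization.submodule_mk, Submodule.mem_map, Submodule.mem_span_pair]
  constructor
  · rintro ⟨y, hy, rfl⟩
    obtain ⟨b, hb⟩ := Submodule.mem_span_singleton.1 (Submodule.mem_comap.1 hy)
    have h := congrArg (tangentEquiv Q hs hB hx h0) hb
    rw [map_smul, tangentEquiv_mkQ, tangentEquiv_mkQ] at h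
    have := mem_submodule_of_direction_eq_zero Q hs hB hx h0 (v := (y : F.Ambient) - b • v)
      (Submodule.sub_mem _ y.2 (Submodule.smul_mem _ _ v.2))
      (by rw [map_sub, map_smul, h, sub_self])
    exact ⟨_, b, by rw [← this]; simp⟩
  · rintro ⟨a, b, rfl⟩
    refine ⟨a • ⟨x.rep, rep_mem_coneTangentSpace hx⟩ + b • v, ?_, rfl⟩
    rw [Submodule.mem_comap, Submodule.mem_span_singleton]
    refine ⟨b, (tangentEquiv Q hs hB hx h0).injective ?_⟩
    rw [map_smul, tangentEquiv_mkQ, tangentEquiv_mkQ]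
    simp [direction_self h0]

/-- The identification of `T_x M(F)` with `W` maps the variety of lines at `x` onto the base
locus. -/
theorem cone_baseLocus_eq_image :
    cone F.baseLocus = tangentEquiv Q hs hB hx h0 '' cone (varietyOfLines F.variety x) := by
  set e := tangentEquiv Q hs hB hx h0 with he
  suffices h : ∀ y, y ∈ cone (varietyOfLines F.variety x) ↔ e y ∈ cone F.baseLocus by
    ext w
    constructor
    · exact fun hw => ⟨e.symm w, (h _).2 (by simpa using hw), by simp⟩
    · rintro ⟨y, hy, rfl⟩
      exact (h y).1 hy
  intro y
  by_cases hy : y = 0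
  · subst hy
    rw [map_zero]
    exact ⟨fun _ => zero_mem_cone _, fun _ => zero_mem_cone _⟩
  obtain ⟨v, rfl⟩ := Submodule.mkQ_surjective _ y
  have hL := lineInDirection_mk Q hs hB hx h0 hy
  have hdv : direction x.rep v ≠ 0 := by
    rw [← tangentEquiv_mkQ Q hs hB hx h0]
    exact fun h => hy ((tangentEquiv Q hs hB hx h0).map_eq_zero_iff.1 h)
  rw [← mk_mem_iff_mem_cone hy, he, tangentEquiv_mkQ]
  simp only [varietyOfLines, Set.mem_ofPred_eq, hL, linesThrough]
  constructor
  · rintro ⟨-, -, h⟩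
    rw [mem_cone_baseLocus Q]
    intro j
    -- the quadrics vanish at the point of the line on the hyperplane `w₀ = 0`
    have hz : (v : F.Ambient) - ((v : F.Ambient).1 / x.rep.1) • x.rep ∈
        Submodule.span ℂ {x.rep, (v : F.Ambient)} :=
      Submodule.sub_mem _ (Submodule.subset_span (by simp))
        (Submodule.smul_mem _ _ (Submodule.subset_span (by simp)))
    have := (mem_cone_quadricLocus Q).1 (cone_variety_subset Q (h hz)) j
    rw [direction_apply]
    simpa [h0] using this.symm
  · intro h
    refine ⟨?_, ?_, ?_⟩
    · have hli : LinearIndependent ℂ ![x.rep, (v : F.Ambient)] := by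
        rw [LinearIndependent.pair_iff]
        intro a b hab
        have hd := congrArg (direction x.rep) hab
        rw [map_add, map_smul, map_smul, direction_self h0, smul_zero, zero_add, map_zero,
          smul_eq_zero, or_iff_left hdv] at hd
        rw [hd, zero_smul, add_zero, smul_eq_zero, or_iff_left x.rep_nonzero] at hab
        exact ⟨hab, hd⟩
      rw [hL]
      have := finrank_span_eq_card hli
      rwa [Matrix.range_cons, Matrix.range_cons, Matrix.range_empty, Set.union_empty,
        Set.singleton_union, Fintype.card_fin] at this
    · rw [x.submodule_eq]
      exact Submodule.span_mono (by simp)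
    · intro z hz
      obtain ⟨a, b, rfl⟩ := Submodule.mem_span_pair.1 hz
      refine mem_cone_variety_of_direction Q hs hB hx h0 ?_ ?_
      · exact Submodule.add_mem _ (Submodule.smul_mem _ _ (rep_mem_coneTangentSpace hx))
          (Submodule.smul_mem _ _ v.2)
      · rw [map_add, map_smul, map_smul, direction_self h0, smul_zero, zero_add]
        exact smul_mem_cone h b

end Tangent

/-! ### The base locus and the hyperplane section `w₀ = 0` -/

variable (F) in
/-- The ideal of the base locus. -/
def idealBaseLocus : Ideal (MvPolynomial (Fin n) ℂ) :=
  MvPolynomial.vanishingIdeal ℂ (cone F.baseLocus)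

variable (F) in
theorem coneDim_baseLocus :
    coneDim F.baseLocus = ringKrullDim (MvPolynomial (Fin n) ℂ ⧸ F.idealBaseLocus) := by
  rw [coneDim_eq (LinearEquiv.refl ℂ (Fin n → ℂ)), idealBaseLocus,
    show ⇑(LinearEquiv.refl ℂ (Fin n → ℂ)) = id from rfl, Set.image_id]

theorem idealBaseLocus_eq_radical : F.idealBaseLocus =
    (Ideal.span (Set.range fun j => (Q j : MvPolynomial (Fin n) ℂ))).radical := by
  rw [← MvPolynomial.vanishingIdeal_zeroLocus_eq_radical (K := ℂ), MvPolynomial.zeroLocus_span,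
    idealBaseLocus]
  congr 1
  ext w
  rw [mem_cone_baseLocus Q]
  simp only [Set.forall_mem_range, Set.mem_ofPred_eq]
  rfl

theorem idealBaseLocus_le_of_isPrime {p : Ideal (MvPolynomial (Fin n) ℂ)} [hp : p.IsPrime]
    (h : ∀ j, (Q j : MvPolynomial (Fin n) ℂ) ∈ p) : F.idealBaseLocus ≤ p := by
  rw [idealBaseLocus_eq_radical Q, hp.radical_le_iff, Ideal.span_le]
  rintro _ ⟨j, rfl⟩
  exact h j

/-- Cutting out by `c` quadrics lowers the dimension by at most `c`. -/
theorem le_add_coneDim_baseLocus (Q : Module.Basis (Fin c) ℂ (F.part 2)) :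
    (n : WithBot ℕ∞) ≤ c + coneDim F.baseLocus := by
  classical
  let S : Finset (MvPolynomial (Fin n) ℂ) := Finset.univ.image fun j => (Q j).1
  have hS : Ideal.span (S : Set (MvPolynomial (Fin n) ℂ)) ≤
      MvPolynomial.vanishingIdeal ℂ {(0 : Fin n → ℂ)} := by
    rw [Ideal.span_le]
    intro q hq
    obtain ⟨j, -, rfl⟩ := Finset.mem_image.1 hq
    exact (MvPolynomial.mem_vanishingIdeal_singleton_iff _ _).2
      ((mem_cone_baseLocus Q).1 (zero_mem_cone _) j)
  obtain ⟨p, hp, -⟩ := Ideal.exists_minimalPrimes_le hS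
  have := hp.isPrime
  have hpc : p.height ≤ c := by
    refine (Ideal.height_le_card_of_mem_minimalPrimes_span_finset hp).trans ?_
    exact_mod_cast Finset.card_image_le.trans_eq (by simp)
  have hle : F.idealBaseLocus ≤ p := idealBaseLocus_le_of_isPrime Q fun j =>
    hp.1.2 (Ideal.subset_span (Finset.mem_image_of_mem _ (Finset.mem_univ j)))
  calc (n : WithBot ℕ∞) ≤ p.height + ringKrullDim (MvPolynomial (Fin n) ℂ ⧸ p) :=
        MvPolynomial.le_height_add_ringKrullDim_quotient p
    _ ≤ c + coneDim F.baseLocus := by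
        rw [coneDim_baseLocus]
        gcongr
        · exact_mod_cast hpc
        · exact ringKrullDim_le_of_surjective (Ideal.Quotient.factor hle)
            (Ideal.Quotient.factor_surjective hle)

/-- The coordinate ring of the product of the affine cone over the base locus with `(F²)^*`. -/
abbrev BoundaryRing (c : ℕ) (F : SymbolSystem n 2) : Type :=
  MvPolynomial (Fin c) (MvPolynomial (Fin n) ℂ ⧸ F.idealBaseLocus)

theorem ringKrullDim_boundaryRing :
    ringKrullDim (BoundaryRing c F) = coneDim F.baseLocus + c := by
  rw [coneDim_baseLocus, MvPolynomial.ringKrullDim_of_isNoetherianRing, Nat.card_fin]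

/-- Putting `w₀ = 0` and separating the variables. -/
def boundarySplit (n c : ℕ) : MvPolynomial (Option (Fin n ⊕ Fin c)) ℂ →ₐ[ℂ]
    MvPolynomial (Fin c) (MvPolynomial (Fin n) ℂ) :=
  MvPolynomial.aeval fun i => i.elim 0
    (Sum.elim (fun i => MvPolynomial.C (MvPolynomial.X i)) MvPolynomial.X)

theorem eval_map_boundarySplit (w : Fin n → ℂ) (η : Module.Dual ℂ (F.part 2))
    (f : MvPolynomial (Option (Fin n ⊕ Fin c)) ℂ) :
    MvPolynomial.eval (fun j => η (Q j))
      (MvPolynomial.map (MvPolynomial.eval w) (boundarySplit n c f)) =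
        MvPolynomial.eval (coords Q ((0, w, η) : F.Ambient)) f := by
  change (((MvPolynomial.eval fun j => η (Q j)).comp
    (MvPolynomial.map (MvPolynomial.eval w))).comp (boundarySplit n c).toRingHom) f = _
  congr 1
  ext i
  · simp
  · rcases i with _ | _ | j <;> simp [boundarySplit]

/-- Restriction of polynomials to the hyperplane section `w₀ = 0` of the zero set of the
quadrics. -/
def toBoundary (c : ℕ) (F : SymbolSystem n 2) :
    MvPolynomial (Option (Fin n ⊕ Fin c)) ℂ →+* BoundaryRing c F :=
  (MvPolynomial.map (Ideal.Quotient.mk F.idealBaseLocus)).comp (boundarySplit n c).toRingHom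

theorem toBoundary_surjective : Function.Surjective (toBoundary c F) := by
  refine (MvPolynomial.map_surjective _ Ideal.Quotient.mk_surjective).comp fun q => ?_
  induction q using MvPolynomial.induction_on with
  | C a =>
    refine ⟨MvPolynomial.rename (fun i => some (Sum.inl i)) a, ?_⟩
    change ((boundarySplit n c).comp (MvPolynomial.rename _)) a = IsScalarTower.toAlgHom ℂ _ _ a
    congr 1
    ext1 i
    simp [boundarySplit, MvPolynomial.algebraMap_eq]
  | add p q hp hq =>
    obtain ⟨p', rfl⟩ := hp
    obtain ⟨q', rfl⟩ := hq
    exact ⟨p' + q', map_add _ _ _⟩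
  | mul_X p j hp =>
    obtain ⟨p', rfl⟩ := hp
    exact ⟨p' * MvPolynomial.X (some (Sum.inr j)), by simp [boundarySplit]⟩

theorem toBoundary_eq_zero {f : MvPolynomial (Option (Fin n ⊕ Fin c)) ℂ}
    (h : ∀ w ∈ cone F.baseLocus, ∀ η : Module.Dual ℂ (F.part 2),
      MvPolynomial.eval (coords Q ((0, w, η) : F.Ambient)) f = 0) : toBoundary c F f = 0 := by
  ext m
  change MvPolynomial.coeff m (MvPolynomial.map _ (boundarySplit n c f)) = _
  rw [MvPolynomial.coeff_map, MvPolynomial.coeff_zero, Ideal.Quotient.eq_zero_iff_mem]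
  intro w hw
  change MvPolynomial.eval w _ = 0
  rw [← MvPolynomial.coeff_map]
  have : MvPolynomial.map (MvPolynomial.eval w) (boundarySplit n c f) = 0 := by
    refine MvPolynomial.funext fun x => ?_
    have := eval_map_boundarySplit Q w (Q.constr ℂ x) f
    simp only [Module.Basis.constr_basis] at this
    rw [this, h w hw, map_zero]
  rw [this, MvPolynomial.coeff_zero]

/-- If `M(F)` is cut out by the quadrics, its hyperplane section `w₀ = 0`, which has dimension one
less, is the cone over the base locus with vertex `ℙ((F²)^*)`. -/
theorem hasCodim_of_isQuadratic (h : IsQuadratic Q) : HasCodim F.baseLocus c := by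
  have hI : idealVariety Q ≤ RingHom.ker (toBoundary c F) := by
    intro f hf
    refine toBoundary_eq_zero Q fun w hw η => (mem_idealVariety Q).1 hf _ ?_
    rw [show F.variety = quadricLocus Q from h, mem_cone_quadricLocus]
    intro j
    rw [(mem_cone_baseLocus Q).1 hw j, zero_mul]
  let T := Ideal.Quotient.mk (idealVariety Q) (MvPolynomial.X none)
  have hT : T ≠ 0 := fun h0 =>
    X_none_notMem_idealVariety Q (Ideal.Quotient.eq_zero_iff_mem.1 h0)
  let φ := Ideal.Quotient.lift (idealVariety Q) (toBoundary c F) hI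
  have hφT : ∀ a ∈ Ideal.span {T}, φ a = 0 := by
    intro a ha
    obtain ⟨b, rfl⟩ := Ideal.mem_span_singleton.1 ha
    have : φ T = 0 := by simp [φ, T, toBoundary, boundarySplit]
    rw [map_mul, this, zero_mul]
  have hsurj : Function.Surjective (Ideal.Quotient.lift (Ideal.span {T}) φ hφT) :=
    Ideal.Quotient.lift_surjective_of_surjective _ _
      (Ideal.Quotient.lift_surjective_of_surjective _ _ toBoundary_surjective)
  have h1 := ringKrullDim_quotient_succ_le_of_nonZeroDivisor (mem_nonZeroDivisors_of_ne_zero hT)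
  have h2 : ringKrullDim (BoundaryRing c F) ≤ ringKrullDim (_ ⧸ Ideal.span {T}) :=
    ringKrullDim_le_of_surjective (Ideal.Quotient.lift (Ideal.span {T}) φ hφT) hsurj
  rw [ringKrullDim_boundaryRing] at h2
  rw [ringKrullDim_quotient_idealVariety] at h1
  have h3 : coneDim F.baseLocus + c + 1 ≤ (n + 1 : ℕ) := le_trans (by gcongr) h1
  have h4 := le_add_coneDim_baseLocus Q
  rw [HasCodim, Module.finrank_fin_fun]
  generalize coneDim F.baseLocus = D at *
  induction D with
  | bot => simp at h4
  | coe D =>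
    induction D using ENat.recTopCoe with
    | top => exact absurd h3 (by norm_cast)
    | coe d =>
      have h3' : d + c + 1 ≤ n + 1 := by exact_mod_cast h3
      have h4' : n ≤ c + d := by exact_mod_cast h4
      exact_mod_cast (by omega : d + c = n)

/-- A prime containing `w₀` and the `Q_j` defines a subset of the product of the affine cone over
the base locus with `(F²)^*`. -/
theorem ringKrullDim_quotient_le_boundaryRing
    (p : Ideal (MvPolynomial (Option (Fin n ⊕ Fin c)) ℂ)) [hp : p.IsPrime]
    (hX : MvPolynomial.X none ∈ p)
    (hQ : ∀ j, MvPolynomial.rename (fun i => some (Sum.inl i))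
      (Q j : MvPolynomial (Fin n) ℂ) ∈ p) :
    ringKrullDim (MvPolynomial (Option (Fin n ⊕ Fin c)) ℂ ⧸ p) ≤
      ringKrullDim (BoundaryRing c F) := by
  let ρ : MvPolynomial (Fin n) ℂ →ₐ[ℂ] MvPolynomial (Option (Fin n ⊕ Fin c)) ℂ :=
    MvPolynomial.rename fun i => some (Sum.inl i)
  have hJ : F.idealBaseLocus ≤ p.comap ρ := idealBaseLocus_le_of_isPrime Q hQ
  let χ : BoundaryRing c F →+* MvPolynomial (Option (Fin n ⊕ Fin c)) ℂ ⧸ p :=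
    MvPolynomial.eval₂Hom
      (Ideal.Quotient.lift F.idealBaseLocus ((Ideal.Quotient.mk p).comp ρ.toRingHom)
        fun a ha => Ideal.Quotient.eq_zero_iff_mem.2 (hJ ha))
      fun j => Ideal.Quotient.mk p (MvPolynomial.X (some (Sum.inr j)))
  refine ringKrullDim_le_of_surjective χ fun y => ?_
  obtain ⟨r, rfl⟩ := Ideal.Quotient.mk_surjective y
  induction r using MvPolynomial.induction_on with
  | C a =>
    refine ⟨MvPolynomial.C (Ideal.Quotient.mk _ (MvPolynomial.C a)), ?_⟩
    simp [χ, ρ]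
  | add r s hr hs =>
    obtain ⟨a, ha⟩ := hr
    obtain ⟨b, hb⟩ := hs
    exact ⟨a + b, by rw [map_add, map_add, ha, hb]⟩
  | mul_X r i hr =>
    obtain ⟨a, ha⟩ := hr
    have hi : ∃ b, χ b = Ideal.Quotient.mk p (MvPolynomial.X i) := by
      rcases i with _ | i | j
      · exact ⟨0, by rw [map_zero, Ideal.Quotient.eq_zero_iff_mem.2 hX]⟩
      · exact ⟨MvPolynomial.C (Ideal.Quotient.mk _ (MvPolynomial.X i)), by simp [χ, ρ]⟩
      · exact ⟨MvPolynomial.X j, by simp [χ]⟩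
    obtain ⟨b, hb⟩ := hi
    exact ⟨a * b, by rw [map_mul, map_mul, ha, hb]⟩

/-- If the base locus has codimension `c`, the hyperplane section `w₀ = 0` of the zero set of the
quadrics has dimension `n - 1`, too small to contain a component of an intersection of `c`
quadrics in `ℙⁿ⁺ᶜ`. -/
theorem isQuadratic_of_hasCodim (h : HasCodim F.baseLocus c) : IsQuadratic Q := by
  refine eq_of_cone_eq (Set.Subset.antisymm (cone_variety_subset Q) fun v hv => ?_)
  by_contra hvM
  rw [mem_cone_variety] at hvM
  push Not at hvM
  obtain ⟨f', hf', hfv⟩ := hvM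
  let f := toCoords (coords Q) f'
  have hf : f ∈ idealVariety Q := (mem_idealVariety_iff_param Q).2 fun t w =>
    (aeval_toCoords (coords Q) _ f').trans (hf' t w)
  let m := MvPolynomial.vanishingIdeal ℂ {coords Q v}
  have hfm : f ∉ m := by
    rw [MvPolynomial.mem_vanishingIdeal_singleton_iff, aeval_toCoords]
    exact hfv
  have hKm : quadricIdeal Q ≤ m := by
    rw [quadricIdeal, Ideal.span_le]
    rintro _ ⟨j, rfl⟩
    refine (MvPolynomial.mem_vanishingIdeal_singleton_iff _ _).2 ?_
    exact (eval_coords_quadric Q v j).trans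
      (sub_eq_zero.2 ((mem_cone_quadricLocus Q).1 hv j))
  -- `p` is a component of the zero set of the quadrics through `v` not contained in `M(F)`
  obtain ⟨p, hp, hpm⟩ := Ideal.exists_minimalPrimes_le hKm
  have hprime := hp.isPrime
  have hX : MvPolynomial.X none ∈ p :=
    (hprime.mem_or_mem (hprime.radical_le_iff.2 hp.1.2 (X_none_mul_mem_radical Q hf))).resolve_right
      fun h => hfm (hpm h)
  have hQ : ∀ j, MvPolynomial.rename (fun i => some (Sum.inl i))
      (Q j : MvPolynomial (Fin n) ℂ) ∈ p := by
    intro j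
    have h1 : quadric Q j ∈ p := hp.1.2 (Ideal.subset_span ⟨j, rfl⟩)
    have h2 := p.sub_mem (p.mul_mem_right (MvPolynomial.X (some (Sum.inr j))) hX) h1
    rwa [quadric, sub_sub_cancel] at h2
  have h1 := ringKrullDim_quotient_le_boundaryRing Q p hX hQ
  rw [HasCodim, Module.finrank_fin_fun] at h
  rw [ringKrullDim_boundaryRing, h] at h1
  have h2 := MvPolynomial.card_le_height_add_ringKrullDim_quotient p
  have h3 : (Nat.card (Option (Fin n ⊕ Fin c)) : WithBot ℕ∞) ≤ c + n :=
    h2.trans (by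
      gcongr
      exact_mod_cast height_le_of_mem_minimalPrimes_quadricIdeal Q hp)
  simp only [Nat.card_eq_fintype_card, Fintype.card_option, Fintype.card_sum,
    Fintype.card_fin] at h3
  have h4 : n + c + 1 ≤ c + n := by exact_mod_cast h3
  omega

theorem isSetTheoreticCI_baseLocus (Q : Module.Basis (Fin c) ℂ (F.part 2))
    (h : HasCodim F.baseLocus c) : IsSetTheoreticCI c F.baseLocus := by
  have hg : ∀ j, 0 < 2 ∧ (MvPolynomial.rename (fun i => (LinearMap.proj i :
      Module.Dual ℂ (Fin n → ℂ))) (Q j : MvPolynomial (Fin n) ℂ)).IsHomogeneous 2 :=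
    fun j => ⟨by norm_num, (F.isHomogeneous_two (Q j)).rename_isHomogeneous⟩
  refine ⟨h, _, fun _ => 2, hg, eq_of_cone_eq ?_⟩
  ext w
  rw [mem_cone_zeroLocus hg, mem_cone_baseLocus Q]
  simp only [evalAt_rename]
  rfl

variable (F) in
/-- The open subset `w₀ ≠ 0` of `M(F)`. -/
def openOrbit : Set (Projectivization ℂ F.Ambient) :=
  F.variety \ zeroLocus {MvPolynomial.X (LinearMap.fst ℂ _ _)}

theorem fst_rep_ne_zero {x : Projectivization ℂ F.Ambient} (hx : x ∈ F.openOrbit) :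
    x.rep.1 ≠ 0 := by
  intro h
  refine hx.2 fun p hp => ?_
  rw [Set.mem_singleton_iff.1 hp, evalAt_X]
  exact h

variable (F) in
theorem isDenseOpenIn_openOrbit : IsDenseOpenIn F.openOrbit F.variety := by
  refine ⟨⟨_, isZariskiClosed_zeroLocus_singleton_X _, rfl⟩, fun x hx => ?_⟩
  rw [← rep_mem_cone_iff, mem_cone_zariskiClosure]
  intro p hp
  refine F.mem_cone_variety.1 (rep_mem_cone_iff.2 hx) p fun t w => ?_
  have key : ∀ s : ℂ, s ≠ 0 → evalAt (F.param s w) p = 0 := by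
    intro s hs
    refine mem_vanishingIdeal.1 hp _ fun hne => ⟨F.param_mem_cone_variety s w hne, fun h0 => ?_⟩
    obtain ⟨a, ha⟩ := Projectivization.exists_smul_eq_mk_rep ℂ _ hne
    have := h0 _ rfl
    rw [evalAt_X, ← ha] at this
    simp [param, hs, Units.smul_def] at this
  by_cases ht : t = 0
  · subst ht
    have hpar : ∀ s : ℂ, F.param s w =
        F.param 0 w + s • ((0, w, 0) : F.Ambient) + s ^ 2 • ((1, 0, 0) : F.Ambient) := by
      intro s
      simp [param]
    refine evalAt_eq_zero_of_forall_ne _ ((0, w, 0) : F.Ambient) ((1, 0, 0) : F.Ambient)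
      fun s hs => ?_
    rw [← hpar]
    exact key s hs
  · exact key t ht

end SymbolSystem

end

end EulerSymmetric

open EulerSymmetric EulerSymmetric.SymbolSystem in
theorem theorem4p1 {n c : ℕ} (F : EulerSymmetric.SymbolSystem n 2)
    (Q : Module.Basis (Fin c) ℂ (F.part 2)) :
    ∃ U : Set (Projectivization ℂ F.Ambient),
      EulerSymmetric.IsDenseOpenIn U F.variety ∧
      ∀ x ∈ U, EulerSymmetric.IsNonsingularPoint F.variety x ∧
        List.TFAE [
          EulerSymmetric.SymbolSystem.IsQuadratic Q,
          EulerSymmetric.IsSetTheoreticCI c F.baseLocus,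
          EulerSymmetric.IsSetTheoreticCI c (EulerSymmetric.varietyOfLines F.variety x),
          EulerSymmetric.HasCodim F.baseLocus c] := by
  refine ⟨F.openOrbit, F.isDenseOpenIn_openOrbit, fun x hx => ?_⟩
  choose B hs hB using fun j => exists_symm_bilin (F.isHomogeneous_two (Q j))
  have h0 := fst_rep_ne_zero hx
  refine ⟨isNonsingularPoint Q hs hB hx.1 h0, ?_⟩
  let e := tangentEquiv Q hs hB hx.1 h0
  have he : cone F.baseLocus = e '' cone (varietyOfLines F.variety x) :=
    cone_baseLocus_eq_image Q hs hB hx.1 h0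
  have he' : cone (varietyOfLines F.variety x) = e.symm '' cone F.baseLocus := by
    rw [he, ← Set.image_comp]
    simp
  have : FiniteDimensional ℂ (TangentSpace F.variety x) := e.symm.finiteDimensional
  tfae_have 1 → 4 := hasCodim_of_isQuadratic Q
  tfae_have 4 → 1 := isQuadratic_of_hasCodim Q
  tfae_have 4 → 2 := isSetTheoreticCI_baseLocus Q
  tfae_have 2 → 3 := IsSetTheoreticCI.of_linearEquiv e.symm he'
  tfae_have 3 → 4 := fun h => (hasCodim_iff_of_linearEquiv e he c).1 h.1
  tfae_finish
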